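/- Let $0<\sigma<1$ and $a>\sigma$. A $C^{1,a}$ curve $\mathcal C\subseteq\mathbb R^2$ is a simple, not necessarily connected planar curve of finite total length that is closed up to its endpoints: a locally finite union of pairwise disjoint components, each of which is a simple regular $C^{1,a}$ arc (regularity up to the endpoints, which may or may not belong to $\mathcal C$) or a simple closed regular $C^{1,a}$ curve. For a set $\mathcal C\subseteq\mathbb R^2$ let $\mathcal X(\mathcal C)$ be the set of pairs $(x,y)$ such that the open segment from $x$ to $y$ is transversal to $\mathcal C$ (at no common point is it parallel to a tangent of $\mathcal C$) and meets $\mathcal C$ in an odd number of points. For $z,u\in\mathbb R^2$ with $|u|=1$ let $\widehat\chi_{\mathcal C}(z,y)$ be $1$ if $(z,y)\notin\mathcal X(\mathcal C)$ and $(z-y)\cdot u>0$, or $(z,y)\in\mathcal X(\mathcal C)$ and $(z-y)\cdot u<0$; let it be $-1$ if $(z,y)\in\mathcal X(\mathcal C)$ and $(z-y)\cdot u>0$, or $(z,y)\notin\mathcal X(\mathcal C)$ and $(z-y)\cdot u<0$; and let it be $0$ otherwise. If $z\in\mathcal C$ and $u$ is normal to $\mathcal C$ at $z$, the nonlocal curvature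 is $$\kappa_\sigma(z,\mathcal C,u)=\lim_{r\downarrow0}\frac12\int_{\mathbb R^2\setminus B_r(z)}\frac{\widehat\chi_{\mathcal C}(z,y)}{|z-y|^{2+\sigma}}\,dy .$$ If $z\notin\mathcal C$ and $u$ is any unit vector, then $\kappa_\sigma(z,\mathcal C,u)=\lim_{\delta\downarrow0}\kappa_\sigma(z,\mathcal C\cup[z-\delta u^\perp,z+\delta u^\perp],u)$, the values on the right being given by the displayed formula, where $u^\perp$ is $u$ rotated clockwise by $90^\circ$. The linear interpolating splines of a connected curve with parameterization $\gamma:[\alpha,\beta]\to\mathbb R^2$ are the sets $\bigcup_{k=1}^n\big[\gamma(\alpha+\tfrac{\beta-\alpha}n(k-1)),\gamma(\alpha+\tfrac{\beta-\alpha}nk)\big]$, $n\ge1$. **Theorem.** Let $\mathcal C$ be a $C^{1,a}$ curve with $a>\sigma$, $z\in\mathbb R^2$ a point, $u$ a unit vector, which is assumed to be normal to $\mathcal C$ at $z$ if $z\in\mathcal C$, and $\varepsilon>0$. Then $\kappa_\sigma(z,\mathcal C,u)$ exists, and there are countably many (possibly finitely many or none) pairwise disjoint connected subcurves $\mathcal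 C_i\subseteq\mathcal C$ and linear interpolating splines $\mathcal S_i$ of $\mathcal C_i$, each for a regular $C^{1,a}$ parameterization of $\mathcal C_i$, such that $\kappa_\sigma(z,\bigcup_i\mathcal S_i,u)$ exists and $$\big|\kappa_\sigma(z,\mathcal C,u)-\kappa_\sigma(z,\textstyle\bigcup_i\mathcal S_i,u)\big|<\varepsilon .$$ -/

import Mathlib

open Set Filter Topology MeasureTheory

/-- The Euclidean plane. -/
abbrev Plane : Type := EuclideanSpace ℝ (Fin 2)

/-- `γ` is a regular parameterization of class `C^{1,a}` on the interval `[α, β]`: it is `C¹` up to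
the endpoints, its derivative does not vanish, and its derivative is Hölder continuous with
exponent `a`. -/
def IsRegularC1Holder (a : ℝ) (γ : ℝ → Plane) (α β : ℝ) : Prop :=
  ContDiffOn ℝ 1 γ (Icc α β) ∧
  (∀ t ∈ Icc α β, derivWithin γ (Icc α β) t ≠ 0) ∧
  ∃ K : ℝ, ∀ s ∈ Icc α β, ∀ t ∈ Icc α β,
    ‖derivWithin γ (Icc α β) s - derivWithin γ (Icc α β) t‖ ≤ K * |s - t| ^ a

/-- `γ : [α, β] → ℝ²` parameterizes a simple `C^{1,a}` arc (with two distinct endpoints). -/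
def IsArcParam (a : ℝ) (γ : ℝ → Plane) (α β : ℝ) : Prop :=
  α < β ∧ IsRegularC1Holder a γ α β ∧ InjOn γ (Icc α β)

/-- `γ : [α, β] → ℝ²` parameterizes a simple closed `C^{1,a}` curve. -/
def IsLoopParam (a : ℝ) (γ : ℝ → Plane) (α β : ℝ) : Prop :=
  α < β ∧ IsRegularC1Holder a γ α β ∧ InjOn γ (Ico α β) ∧ γ α = γ β ∧
  derivWithin γ (Icc α β) α = derivWithin γ (Icc α β) β

/-- `C` is a simple `C^{1,a}` planar curve of finite length, not necessarily connected: the union of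
pairwise disjoint simple `C^{1,a}` arcs, each with or without its endpoints, and simple closed
`C^{1,a}` curves. Only finitely many of them meet a neighborhood of any given point of the plane
(so `C`, with its endpoints added, is a closed set and an embedded manifold with boundary), and the
sum of their lengths is finite. The component with index `i` is the image of `I i ⊆ [0, 1]`. -/
def IsC1HolderCurve (a : ℝ) (C : Set Plane) : Prop :=
  ∃ (ι : Type) (γ : ι → ℝ → Plane) (I : ι → Set ℝ),
    (∀ i, (IsArcParam a (γ i) 0 1 ∧ Ioo 0 1 ⊆ I i ∧ I i ⊆ Icc 0 1) ∨
      (IsLoopParam a (γ i) 0 1 ∧ I i = Icc 0 1)) ∧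
    Pairwise (fun i j => Disjoint (γ i '' Icc 0 1) (γ j '' Icc 0 1)) ∧
    LocallyFinite (fun i => γ i '' Icc 0 1) ∧
    ∑' i, ∫⁻ t in Icc (0 : ℝ) 1, ‖derivWithin (γ i) (Icc 0 1) t‖ₑ ≠ ⊤ ∧
    C = ⋃ i, γ i '' I i

/-- The open segment between `x` and `y` is transversal to `C`: at each common point it is not
parallel to a tangent of `C`. (At a point of a `C¹` curve, possibly an endpoint, the tangent cone is
the whole tangent line; at a corner it is the union of the tangent lines of the two sides.) -/
def IsTransversal (C : Set Plane) (x y : Plane) : Prop :=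
  ∀ p ∈ C ∩ openSegment ℝ x y, y - x ∉ tangentConeAt ℝ C p

/-- The pairs `(x, y)` for which the open segment between `x` and `y` is transversal to `C` and
meets `C` in an odd number of points. -/
def oddPairs (C : Set Plane) : Set (Plane × Plane) :=
  {q | IsTransversal C q.1 q.2 ∧ (C ∩ openSegment ℝ q.1 q.2).Finite ∧
    Odd (C ∩ openSegment ℝ q.1 q.2).ncard}

/-- The exterior of `C` at `z` relative to `u`. -/
def exteriorSet (C : Set Plane) (z u : Plane) : Set Plane :=
  {y | ((z, y) ∈ oddPairs C ∧ 0 < inner ℝ (z - y) u) ∨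
    ((z, y) ∉ oddPairs C ∧ inner ℝ (z - y) u < 0)}

/-- The interior of `C` at `z` relative to `u`. -/
def interiorSet (C : Set Plane) (z u : Plane) : Set Plane :=
  {y | ((z, y) ∉ oddPairs C ∧ 0 < inner ℝ (z - y) u) ∨
    ((z, y) ∈ oddPairs C ∧ inner ℝ (z - y) u < 0)}

open Classical in
/-- The function equal to `1` on the interior, `-1` on the exterior and `0` elsewhere. -/
noncomputable def chiHat (C : Set Plane) (z u y : Plane) : ℝ :=
  if y ∈ interiorSet C z u then 1 else if y ∈ exteriorSet C z u then -1 else 0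

/-- `k` is the principal value of `½ ∫ chiHat / |z - y|^(2+σ) dy` at `z`; the truncated integrals are
required to converge absolutely. -/
def HasPrincipalValue (σ : ℝ) (C : Set Plane) (z u : Plane) (k : ℝ) : Prop :=
  (∀ r > 0, IntegrableOn (fun y => chiHat C z u y / ‖z - y‖ ^ (2 + σ)) (Metric.ball z r)ᶜ) ∧
  Tendsto (fun r : ℝ => (1 / 2) *
    ∫ y in (Metric.ball z r)ᶜ, chiHat C z u y / ‖z - y‖ ^ (2 + σ)) (𝓝[>] 0) (𝓝 k)

/-- `u` is orthogonal to `C` at `z`. -/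
def IsNormalAt (C : Set Plane) (z u : Plane) : Prop :=
  ∀ v ∈ tangentConeAt ℝ C z, inner ℝ u v = 0

/-- The vector obtained by rotating `u` clockwise by a right angle. -/
noncomputable def perp (u : Plane) : Plane := !₂[u 1, -u 0]

/-- The nonlocal curvature `κ_σ(z, C, u)` is defined and equal to `k`. For `z ∈ C` the vector `u` has
to be normal to `C` at `z` and `k` is the principal value. For `z ∉ C` it is the limit, as `δ ↓ 0`,
of the values for `C` together with the segment of half-length `δ` centered at `z` and
orthogonal to `u`. -/
def HasNonlocalCurvature (σ : ℝ) (C : Set Plane) (z u : Plane) (k : ℝ) : Prop :=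
  (z ∈ C ∧ IsNormalAt C z u ∧ HasPrincipalValue σ C z u k) ∨
  (z ∉ C ∧ ∃ f : ℝ → ℝ,
    (∀ᶠ δ in 𝓝[>] (0 : ℝ),
      HasPrincipalValue σ (C ∪ segment ℝ (z - δ • perp u) (z + δ • perp u)) z u (f δ)) ∧
    Tendsto f (𝓝[>] 0) (𝓝 k))

/-- The nonlocal curvature has at most one value. -/
theorem HasNonlocalCurvature.unique {σ : ℝ} {C : Set Plane} {z u : Plane} {k l : ℝ}
    (hk : HasNonlocalCurvature σ C z u k) (hl : HasNonlocalCurvature σ C z u l) : k = l := by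
  rcases hk with ⟨hz, _, hk⟩ | ⟨hz, f, hf, hk⟩ <;> rcases hl with ⟨hz', _, hl⟩ | ⟨hz', g, hg, hl⟩
  · exact tendsto_nhds_unique hk.2 hl.2
  · exact absurd hz hz'
  · exact absurd hz' hz
  · refine tendsto_nhds_unique hk (hl.congr' ?_)
    filter_upwards [hf, hg] with δ h1 h2 using tendsto_nhds_unique h2.2 h1.2

/-- The linear interpolating spline of the parameterization `γ : [α, β] → ℝ²` for the uniform
partition of `[α, β]` into `n` intervals. -/
def linearSpline (γ : ℝ → Plane) (α β : ℝ) (n : ℕ) : Set Plane :=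
  ⋃ k ∈ Finset.Icc 1 n,
    segment ℝ (γ (α + (β - α) / n * ((k : ℝ) - 1))) (γ (α + (β - α) / n * (k : ℝ)))

/-- `D` is a connected simple `C^{1,a}` curve and `S` is a linear interpolating spline of `D`. -/
def IsLinearSplineOf (a : ℝ) (D S : Set Plane) : Prop :=
  ∃ (γ : ℝ → Plane) (α β : ℝ) (n : ℕ), 1 ≤ n ∧
    (IsArcParam a γ α β ∨ IsLoopParam a γ α β) ∧
    D = γ '' Icc α β ∧ S = linearSpline γ α β n

/-!
Write `N(y)` for the number of points in which the open segment from `z` to `y` meets the curve. For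
almost every `y` the function `chiHat` is `sgn ((z - y) · u) * (1 - 2 * 1_O(y))`, where `O` is the
set of the `y` with odd `N(y)` (`oddSet`). The function `sgn ((z - y) · u) / |z - y|^(2 + σ)` is odd
about `z`, so that its integral over the complement of a disc about `z` vanishes; hence the nonlocal
curvature is `-∫_O sgn ((z - y) · u) / |z - y|^(2 + σ) dy` (`curvatureIntegral`) as soon as this
integral converges absolutely. This covers both cases of the definition, since the segment that is
added if `z` is not on the curve lies on the line through `z` orthogonal to `u`, and is missed by
almost every segment from `z`.

*Convergence.* Only the behavior near `z` matters. There `O` is contained in the points hidden by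
the curve, and if the curve reaches `z`, its Hölder exponent `a` confines these to cusps
`|det (d, y - z)| ≤ M |y - z|^(1 + a)` about tangents `d`, over which the kernel is integrable
because of `a > σ` (`integrableOn_kernelAt_thinCusp`, `HasIntegrableShadow`). Almost every segment
is transversal by Sard's theorem for the central projection from `z`
(`IsRegularArc.ae_isGenericFor`).

*Approximation.* Since only `O` enters, dominated convergence (`tendsto_curvatureIntegral`) reduces
the approximation to the convergence of the parity of `N(y)` for almost every `y`. It is applied
twice. First `C` is cut at `z` and exhausted by finitely many disjoint closed arcs that avoid `z`:
a generic segment has finitely many crossings, and all of them are on these arcs eventually. Then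
the arcs are replaced by their splines. The difference between an arc and its spline is Lipschitz
with a small constant (`IsRegularArc.exists_param_linearSpline`), and such perturbations preserve
the number of crossings of a generic segment (`eventually_mem_oddSet_iff`). The splines stay away
from `z`, which dominates the second limit. So finitely many subcurves, none of them through `z`,
suffice.
-/

/-! ### Determinants and lines in the plane -/

/-- The determinant `det (v, w)` of two vectors of the plane, as a linear functional of `w`. It
vanishes exactly if `v` and `w` are parallel. -/
noncomputable def planeDet (v : Plane) : Plane →L[ℝ] ℝ :=
  v 0 • EuclideanSpace.proj 1 - v 1 • EuclideanSpace.proj 0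

theorem planeDet_apply (v w : Plane) : planeDet v w = v 0 * w 1 - v 1 * w 0 := by
  simp [planeDet]

theorem planeDet_self (v : Plane) : planeDet v v = 0 := by
  rw [planeDet_apply]; ring

theorem planeDet_swap (v w : Plane) : planeDet v w = -planeDet w v := by
  rw [planeDet_apply, planeDet_apply]; ring

theorem planeDet_perp_self (v : Plane) : planeDet v (perp v) = -‖v‖ ^ 2 := by
  simp [planeDet_apply, perp, EuclideanSpace.norm_sq_eq, Fin.sum_univ_two]; ring

theorem norm_perp (v : Plane) : ‖perp v‖ = ‖v‖ := by
  rw [EuclideanSpace.norm_eq, EuclideanSpace.norm_eq]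
  simp [perp, Fin.sum_univ_two, add_comm]

theorem abs_planeDet_le (v w : Plane) : |planeDet v w| ≤ ‖v‖ * ‖w‖ := by
  have h : planeDet v w = -inner ℝ (perp v) w := by
    simp [planeDet_apply, perp, PiLp.inner_apply, Fin.sum_univ_two]; ring
  rw [h, abs_neg, ← norm_perp v]
  exact abs_real_inner_le_norm _ _

/-- The coordinates of `w` in the orthogonal basis formed by `v` and its rotation. -/
theorem normSq_smul_eq (v w : Plane) :
    ‖v‖ ^ 2 • w = inner ℝ v w • v - planeDet v w • perp v := by
  ext i
  fin_cases i <;>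
    simp [planeDet_apply, perp, EuclideanSpace.norm_sq_eq, Fin.sum_univ_two, PiLp.inner_apply] <;>
    ring

theorem exists_smul_of_planeDet_eq_zero {v w : Plane} (hv : v ≠ 0) (h : planeDet v w = 0) :
    ∃ c : ℝ, w = c • v := by
  have hn : ‖v‖ ^ 2 ≠ 0 := by positivity
  refine ⟨(‖v‖ ^ 2)⁻¹ * inner ℝ v w, ?_⟩
  have := normSq_smul_eq v w
  rw [h, zero_smul, sub_zero] at this
  rw [mul_smul, ← this, smul_smul, inv_mul_cancel₀ hn, one_smul]

theorem ae_apply_sub_ne_zero (z : Plane) {l : Plane →L[ℝ] ℝ} (hl : l ≠ 0) :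
    ∀ᵐ y : Plane, l (y - z) ≠ 0 := by
  have h1 : volume ((LinearMap.ker (l : Plane →ₗ[ℝ] ℝ) : Submodule ℝ Plane) : Set Plane) = 0 := by
    apply Measure.addHaar_submodule
    intro h
    exact hl (ContinuousLinearMap.ext fun x => by
      have : x ∈ LinearMap.ker (l : Plane →ₗ[ℝ] ℝ) := h ▸ Submodule.mem_top
      simpa using this)
  have h2 : ∀ᵐ y : Plane, l y ≠ 0 := by
    rw [ae_iff]
    convert h1 using 2
    ext y; simp
  exact (measurePreserving_sub_right volume z).quasiMeasurePreserving.ae h2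

theorem planeDet_ne_zero {v : Plane} (hv : v ≠ 0) : planeDet v ≠ 0 := by
  intro h
  have := planeDet_perp_self v
  rw [h] at this
  simp at this
  exact hv this

theorem ae_planeDet_sub_ne_zero (z : Plane) {v : Plane} (hv : v ≠ 0) :
    ∀ᵐ y : Plane, planeDet v (y - z) ≠ 0 :=
  ae_apply_sub_ne_zero z (planeDet_ne_zero hv)

theorem ae_inner_sub_ne_zero (z : Plane) {u : Plane} (hu : u ≠ 0) :
    ∀ᵐ y : Plane, inner ℝ (z - y) u ≠ 0 := by
  have : innerSL ℝ u ≠ 0 := by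
    intro h
    have : innerSL ℝ u u = 0 := by rw [h]; rfl
    simp at this
    exact hu this
  filter_upwards [ae_apply_sub_ne_zero z this] with y hy h
  apply hy
  rw [innerSL_apply_apply, ← neg_sub, inner_neg_right, real_inner_comm, h, neg_zero]

theorem mem_openSegment_iff {z y p : Plane} :
    p ∈ openSegment ℝ z y ↔ ∃ s ∈ Ioo (0 : ℝ) 1, p = z + s • (y - z) := by
  rw [openSegment_eq_image']
  constructor
  · rintro ⟨s, hs, rfl⟩; exact ⟨s, hs, rfl⟩
  · rintro ⟨s, hs, rfl⟩; exact ⟨s, hs, rfl⟩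

theorem mem_segment_iff {z y p : Plane} :
    p ∈ segment ℝ z y ↔ ∃ s ∈ Icc (0 : ℝ) 1, p = z + s • (y - z) := by
  rw [segment_eq_image']
  constructor
  · rintro ⟨s, hs, rfl⟩; exact ⟨s, hs, rfl⟩
  · rintro ⟨s, hs, rfl⟩; exact ⟨s, hs, rfl⟩

theorem isClosed_segment (z y : Plane) : IsClosed (segment ℝ z y) := by
  rw [segment_eq_image']
  exact (isCompact_Icc.image (by fun_prop)).isClosed

theorem planeDet_sub_eq_zero_of_mem_segment {z y p : Plane} (h : p ∈ segment ℝ z y) :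
    planeDet (y - z) (p - z) = 0 := by
  obtain ⟨s, -, rfl⟩ := mem_segment_iff.1 h
  rw [add_sub_cancel_left, map_smul, planeDet_self, smul_zero]

/-- The open segment is the part of the line through its endpoints in an open strip. -/
theorem mem_openSegment_iff_planeDet {z y p : Plane} (hyz : y ≠ z) :
    p ∈ openSegment ℝ z y ↔ planeDet (y - z) (p - z) = 0 ∧
      0 < inner ℝ (y - z) (p - z) ∧ inner ℝ (y - z) (p - z) < ‖y - z‖ ^ 2 := by
  have hv : y - z ≠ 0 := sub_ne_zero.2 hyz
  have hn : 0 < ‖y - z‖ ^ 2 := by positivity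
  constructor
  · intro h
    refine ⟨planeDet_sub_eq_zero_of_mem_segment (openSegment_subset_segment _ _ _ h), ?_⟩
    obtain ⟨s, hs, rfl⟩ := mem_openSegment_iff.1 h
    rw [add_sub_cancel_left, inner_smul_right, real_inner_self_eq_norm_sq]
    exact ⟨mul_pos hs.1 hn, by nlinarith [hs.2]⟩
  · rintro ⟨h0, h1, h2⟩
    obtain ⟨s, hs⟩ := exists_smul_of_planeDet_eq_zero hv h0
    rw [hs, inner_smul_right, real_inner_self_eq_norm_sq] at h1 h2
    refine mem_openSegment_iff.2 ⟨s, ⟨pos_of_mul_pos_left h1 hn.le, ?_⟩, by rw [← hs]; abel⟩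
    by_contra h
    nlinarith [not_lt.1 h]

theorem norm_sub_lt_of_mem_openSegment {z y p : Plane} (hyz : y ≠ z)
    (h : p ∈ openSegment ℝ z y) : ‖p - z‖ < ‖y - z‖ := by
  obtain ⟨s, hs, rfl⟩ := mem_openSegment_iff.1 h
  have hn : 0 < ‖y - z‖ := norm_pos_iff.2 (sub_ne_zero.2 hyz)
  rw [add_sub_cancel_left, norm_smul, Real.norm_eq_abs, abs_of_pos hs.1]
  nlinarith [hs.2]

theorem ne_left_of_mem_openSegment {z y p : Plane} (hyz : y ≠ z)
    (h : p ∈ openSegment ℝ z y) : p ≠ z := by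
  obtain ⟨s, hs, rfl⟩ := mem_openSegment_iff.1 h
  simp [hs.1.ne', sub_ne_zero.2 hyz]

/-! ### Tangent cones -/

theorem tangentConeAt_union {s t : Set Plane} {x : Plane} :
    tangentConeAt ℝ (s ∪ t) x ⊆ tangentConeAt ℝ s x ∪ tangentConeAt ℝ t x := by
  intro y hy
  rw [tangentConeAt_def, mem_ofPred_eq, preimage_union, nhdsWithin_union, ← map₂_smul,
    map₂_sup_right, clusterPt_sup] at hy
  rw [tangentConeAt_def, tangentConeAt_def]
  exact hy

theorem notMem_tangentConeAt_biUnion {ι : Type*} (F : Finset ι) {s : ι → Set Plane} {x v : Plane}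
    (h : ∀ i ∈ F, v ∉ tangentConeAt ℝ (s i) x) : v ∉ tangentConeAt ℝ (⋃ i ∈ F, s i) x := by
  classical
  induction F using Finset.induction_on with
  | empty =>
    intro hv
    simpa using mem_closure_of_nonempty_tangentConeAt ⟨v, hv⟩
  | insert i F _ ih =>
    rw [Finset.set_biUnion_insert]
    intro hv
    rcases tangentConeAt_union hv with hv | hv
    · exact h i (Finset.mem_insert_self _ _) hv
    · exact ih (fun j hj => h j (Finset.mem_insert_of_mem hj)) hv

/-- On a segment the determinant with its direction is constant, so that both its differential and
the zero functional are derivatives within the segment. -/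
theorem planeDet_eq_zero_of_mem_tangentConeAt_segment {b c p v : Plane}
    (hv : v ∈ tangentConeAt ℝ (segment ℝ b c) p) : planeDet (c - b) v = 0 := by
  have hp : p ∈ segment ℝ b c :=
    (isClosed_segment b c).closure_eq ▸ mem_closure_of_nonempty_tangentConeAt ⟨v, hv⟩
  have h1 : HasFDerivWithinAt (fun q => planeDet (c - b) (q - b)) (planeDet (c - b))
      (segment ℝ b c) p := by
    have := (planeDet (c - b)).hasFDerivWithinAt (s := segment ℝ b c) (x := p)
    simp only [map_sub (planeDet (c - b)) _ b]
    exact this.sub_const _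
  have h2 : HasFDerivWithinAt (fun q => planeDet (c - b) (q - b)) (0 : Plane →L[ℝ] ℝ)
      (segment ℝ b c) p :=
    (hasFDerivWithinAt_const (0 : ℝ) p _).congr (fun q hq => planeDet_sub_eq_zero_of_mem_segment hq)
      (planeDet_sub_eq_zero_of_mem_segment hp)
  exact h1.unique_on h2 hv

/-! ### Measurability of the parity of intersection numbers -/

/-- The points `y` for which the open segment from `z` to `y` meets `A` in an odd number of points;
in contrast to `oddPairs`, transversality is not required. -/
def oddSet (A : Set Plane) (z : Plane) : Set Plane :=
  {y | (A ∩ openSegment ℝ z y).Finite ∧ Odd (A ∩ openSegment ℝ z y).ncard}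

theorem natCast_le_encard_iff {α : Type*} {s : Set α} {k : ℕ} :
    (k : ℕ∞) ≤ s.encard ↔ ∃ f : Fin k → α, Function.Injective f ∧ ∀ i, f i ∈ s := by
  constructor
  · intro h
    obtain ⟨t, hts, ht⟩ := exists_subset_encard_eq h
    have hfin : t.Finite := finite_of_encard_eq_coe ht
    have : Fintype t := hfin.fintype
    have hc : Fintype.card t = k := by
      rw [← Nat.card_eq_fintype_card, Nat.card_coe_set_eq, Set.ncard, ht]; rfl
    let e := (Fintype.equivFinOfCardEq hc).symm
    exact ⟨fun i => e i, Subtype.val_injective.comp e.injective, fun i => hts (e i).2⟩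
  · rintro ⟨f, hf, hs⟩
    calc (k : ℕ∞) = (range f).encard := by
          rw [← image_univ, hf.injOn.encard_image, encard_univ]; simp
      _ ≤ s.encard := encard_le_encard (range_subset_iff.2 hs)

theorem finite_and_odd_iff {α : Type*} {s : Set α} :
    (s.Finite ∧ Odd s.ncard) ↔
      ∃ k : ℕ, Odd k ∧ (k : ℕ∞) ≤ s.encard ∧ ¬ ((k + 1 : ℕ) : ℕ∞) ≤ s.encard := by
  constructor
  · rintro ⟨hs, ho⟩
    refine ⟨s.ncard, ho, ?_, ?_⟩ <;> rw [← hs.cast_ncard_eq, Nat.cast_le]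
    omega
  · rintro ⟨k, hk, h1, h2⟩
    have hs : s.Finite := by
      rw [← encard_ne_top_iff]
      intro h
      rw [h] at h2
      exact h2 le_top
    rw [← hs.cast_ncard_eq, Nat.cast_le] at h1 h2
    have : s.ncard = k := by omega
    exact ⟨hs, this ▸ hk⟩

/-- The points `y` such that the open segment from `z` to `y` meets a closed set in at least `k`
points form a countable union of closed sets: restrict the `k` parameters to have distance at least
`1 / (m + 1)` from each other and from `0` and `1`, and project along their compact range. -/
theorem measurableSet_exists_injective {A : Set Plane} (hA : IsClosed A) (z : Plane) (k : ℕ) :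
    MeasurableSet {y | ∃ t : Fin k → ℝ, Function.Injective t ∧
      ∀ i, t i ∈ Ioo (0 : ℝ) 1 ∧ z + t i • (y - z) ∈ A} := by
  let Q : ℕ → Set (Plane × (Fin k → Icc (0 : ℝ) 1)) := fun m =>
    {q | (∀ i j, i ≠ j → 1 / ((m : ℝ) + 1) ≤ |(q.2 i : ℝ) - q.2 j|) ∧
      ∀ i, 1 / ((m : ℝ) + 1) ≤ (q.2 i : ℝ) ∧ (q.2 i : ℝ) ≤ 1 - 1 / ((m : ℝ) + 1) ∧
        z + (q.2 i : ℝ) • (q.1 - z) ∈ A}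
  have hQ : ∀ m, IsClosed (Q m) := by
    intro m
    simp only [Q, ofPred_and, ofPred_forall]
    refine IsClosed.inter ?_ (isClosed_iInter fun i => IsClosed.inter ?_ (IsClosed.inter ?_ ?_))
    · refine isClosed_iInter fun i => isClosed_iInter fun j => isClosed_iInter fun _ => ?_
      exact isClosed_le continuous_const (by fun_prop)
    · exact isClosed_le continuous_const (by fun_prop)
    · exact isClosed_le (by fun_prop) continuous_const
    · exact hA.preimage (by fun_prop)
  have h : {y | ∃ t : Fin k → ℝ, Function.Injective t ∧
      ∀ i, t i ∈ Ioo (0 : ℝ) 1 ∧ z + t i • (y - z) ∈ A} = ⋃ m, Prod.fst '' Q m := by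
    ext y
    simp only [mem_ofPred_eq, mem_iUnion, mem_image, Prod.exists, exists_and_right, exists_eq_right]
    constructor
    · rintro ⟨t, hinj, ht⟩
      have hev : ∀ x : ℝ, 0 < x → ∀ᶠ m : ℕ in atTop, 1 / ((m : ℝ) + 1) ≤ x := fun x hx =>
        (tendsto_one_div_add_atTop_nhds_zero_nat.eventually_le_const hx)
      have h1 : ∀ᶠ m : ℕ in atTop, ∀ i j, i ≠ j → 1 / ((m : ℝ) + 1) ≤ |t i - t j| := by
        refine eventually_all.2 fun i => eventually_all.2 fun j => ?_
        by_cases hij : i = j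
        · exact Eventually.of_forall fun m h => absurd hij h
        · filter_upwards [hev _ (abs_pos.2 (sub_ne_zero.2 (hinj.ne hij)))] with m hm _ using hm
      have h2 : ∀ᶠ m : ℕ in atTop, ∀ i, 1 / ((m : ℝ) + 1) ≤ t i :=
        eventually_all.2 fun i => hev _ (ht i).1.1
      have h3 : ∀ᶠ m : ℕ in atTop, ∀ i, 1 / ((m : ℝ) + 1) ≤ 1 - t i :=
        eventually_all.2 fun i => hev _ (sub_pos.2 (ht i).1.2)
      obtain ⟨m, hm1, hm2, hm3⟩ := (h1.and (h2.and h3)).exists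
      exact ⟨m, fun i => ⟨t i, (ht i).1.1.le, (ht i).1.2.le⟩, hm1,
        fun i => ⟨hm2 i, by linarith [hm3 i], (ht i).2⟩⟩
    · rintro ⟨m, t, h1, h2⟩
      have hm : 0 < 1 / ((m : ℝ) + 1) := by positivity
      refine ⟨fun i => t i, fun i j hij => ?_, fun i => ⟨⟨by linarith [(h2 i).1],
        by linarith [(h2 i).2.1]⟩, (h2 i).2.2⟩⟩
      by_contra hne
      have := h1 i j hne
      simp only at hij
      simp only [hij, sub_self, abs_zero] at this
      linarith
  rw [h]
  exact MeasurableSet.iUnion fun m => (isClosedMap_fst_of_compactSpace _ (hQ m)).measurableSet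

theorem nullMeasurableSet_oddSet {A : Set Plane} (hA : IsClosed A) (z : Plane) :
    NullMeasurableSet (oddSet A z) := by
  let N : ℕ → Set Plane := fun k => {y | ∃ t : Fin k → ℝ, Function.Injective t ∧
      ∀ i, t i ∈ Ioo (0 : ℝ) 1 ∧ z + t i • (y - z) ∈ A}
  have hN : ∀ k, MeasurableSet (N k) := measurableSet_exists_injective hA z
  have hmeas : MeasurableSet (⋃ k ∈ {k : ℕ | Odd k}, N k \ N (k + 1)) :=
    MeasurableSet.biUnion (to_countable _) fun k _ => (hN k).diff (hN (k + 1))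
  refine hmeas.nullMeasurableSet.congr ?_
  have hne : ∀ᵐ y : Plane, y ≠ z := Measure.ae_ne volume z
  have key : ∀ y, y ≠ z → ∀ k : ℕ, (y ∈ N k ↔ (k : ℕ∞) ≤ (A ∩ openSegment ℝ z y).encard) := by
    intro y hy k
    have hv : y - z ≠ 0 := sub_ne_zero.2 hy
    rw [natCast_le_encard_iff]
    constructor
    · rintro ⟨t, hinj, ht⟩
      refine ⟨fun i => z + t i • (y - z), fun i j hij => hinj ?_, fun i => ⟨(ht i).2,
        mem_openSegment_iff.2 ⟨_, (ht i).1, rfl⟩⟩⟩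
      exact smul_left_injective ℝ hv (add_left_cancel hij)
    · rintro ⟨f, hinj, hf⟩
      choose t ht hft using fun i => mem_openSegment_iff.1 (hf i).2
      refine ⟨t, fun i j hij => hinj ?_, fun i => ⟨ht i, hft i ▸ (hf i).1⟩⟩
      rw [hft i, hft j, hij]
  filter_upwards [hne] with y hy
  refine propext ?_
  change y ∈ ⋃ k ∈ {k : ℕ | Odd k}, N k \ N (k + 1) ↔ y ∈ oddSet A z
  simp only [oddSet, mem_ofPred_eq, finite_and_odd_iff, mem_iUnion, exists_prop, Set.mem_sdiff,
    key y hy]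

/-! ### The kernel and its principal values -/

/-- The kernel `|z - y|^{-(2 + σ)}`, with the value `0` at `y = z`. -/
noncomputable def kernelAt (σ : ℝ) (z y : Plane) : ℝ := (‖z - y‖ ^ (2 + σ))⁻¹

/-- The sign of `(z - y) · u`, which tells on which side of the line through `z` orthogonal to `u`
the point `y` lies. -/
noncomputable def sideSign (z u y : Plane) : ℝ := Real.sign (inner ℝ (z - y) u)

theorem kernelAt_nonneg (σ : ℝ) (z y : Plane) : 0 ≤ kernelAt σ z y := by
  unfold kernelAt; positivity

theorem measurable_kernelAt (σ : ℝ) (z : Plane) : Measurable (kernelAt σ z) := by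
  unfold kernelAt; fun_prop

theorem measurable_sideSign (z u : Plane) : Measurable (sideSign z u) := by
  have hs : Measurable Real.sign := by
    unfold Real.sign
    exact Measurable.ite measurableSet_Iio measurable_const
      (Measurable.ite measurableSet_Ioi measurable_const measurable_const)
  have : Continuous fun y : Plane => (inner ℝ (z - y) u : ℝ) := by fun_prop
  exact hs.comp this.measurable

theorem abs_sideSign_le (z u y : Plane) : |sideSign z u y| ≤ 1 := by
  unfold sideSign
  rcases Real.sign_apply_eq (inner ℝ (z - y) u) with h | h | h <;> simp [h]

theorem integrableOn_kernelAt_compl_ball {σ : ℝ} (hσ : 0 < σ) (z : Plane) {r : ℝ} (hr : 0 < r) :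
    IntegrableOn (kernelAt σ z) (Metric.ball z r)ᶜ := by
  have h1 : Integrable (fun x : Plane => (1 + ‖x‖) ^ (-(2 + σ))) :=
    integrable_one_add_norm (by simp [hσ])
  have h2 := (h1.comp_sub_left z).const_mul ((1 / r + 1) ^ (2 + σ))
  refine Integrable.mono' h2.integrableOn (measurable_kernelAt σ z).aestronglyMeasurable ?_
  refine (ae_restrict_iff' Metric.isOpen_ball.measurableSet.compl).2 (Eventually.of_forall ?_)
  intro y hy
  have hy' : r ≤ ‖z - y‖ := by
    rw [← dist_eq_norm, dist_comm]; simpa using hy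
  have hp : 0 < ‖z - y‖ := hr.trans_le hy'
  rw [Real.norm_eq_abs, abs_of_nonneg (kernelAt_nonneg _ _ _), kernelAt,
    Real.rpow_neg (by positivity), ← div_eq_mul_inv, ← one_div, div_le_div_iff₀ (by positivity)
    (by positivity), one_mul, ← Real.mul_rpow (by positivity) hp.le]
  apply Real.rpow_le_rpow (by positivity) _ (by linarith)
  have : 1 ≤ 1 / r * ‖z - y‖ := by
    rw [one_div, inv_mul_eq_div, one_le_div hr]; exact hy'
  linarith

theorem integrableOn_sideSign_mul {σ : ℝ} {z : Plane} (u : Plane) {s : Set Plane}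
    (h : IntegrableOn (kernelAt σ z) s) :
    IntegrableOn (fun y => sideSign z u y * kernelAt σ z y) s := by
  refine Integrable.mono' h
    ((measurable_sideSign z u).mul (measurable_kernelAt σ z)).aestronglyMeasurable
    (Eventually.of_forall fun y => ?_)
  rw [norm_mul, Real.norm_eq_abs, Real.norm_eq_abs, abs_of_nonneg (kernelAt_nonneg _ _ _)]
  exact mul_le_of_le_one_left (kernelAt_nonneg _ _ _) (abs_sideSign_le _ _ _)

theorem chiHat_eq (A : Set Plane) (z u y : Plane) [Decidable ((z, y) ∈ oddPairs A)] :
    chiHat A z u y = sideSign z u y - 2 * if (z, y) ∈ oddPairs A then sideSign z u y else 0 := by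
  unfold chiHat sideSign
  rcases lt_trichotomy (inner ℝ (z - y) u) 0 with h | h | h
  · rw [Real.sign_of_neg h]
    by_cases ho : (z, y) ∈ oddPairs A
    · simp [interiorSet, ho, h]; norm_num
    · simp [interiorSet, exteriorSet, ho, h, h.not_gt]
  · rw [h]
    simp [interiorSet, exteriorSet, h]
  · rw [Real.sign_of_pos h]
    by_cases ho : (z, y) ∈ oddPairs A
    · simp [interiorSet, exteriorSet, ho, h, h.not_gt]; norm_num
    · simp [interiorSet, ho, h]

theorem sideSign_reflect (z u y : Plane) : sideSign z u (z + z - y) = -sideSign z u y := by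
  unfold sideSign
  rw [← Real.sign_neg, ← inner_neg_left]
  congr 2
  abel

theorem kernelAt_reflect (σ : ℝ) (z y : Plane) : kernelAt σ z (z + z - y) = kernelAt σ z y := by
  unfold kernelAt
  rw [← norm_neg]
  congr 3
  abel

/-- The integral of an odd function over the complement of a disc vanishes. -/
theorem setIntegral_sideSign_mul_kernelAt_compl_ball (σ : ℝ) (z u : Plane) (r : ℝ) :
    ∫ y in (Metric.ball z r)ᶜ, sideSign z u y * kernelAt σ z y = 0 := by
  rw [← integral_indicator Metric.isOpen_ball.measurableSet.compl]
  set F := (Metric.ball z r)ᶜ.indicator fun y => sideSign z u y * kernelAt σ z y with hF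
  have h1 : ∀ y, F (z + z - y) = -F y := by
    intro y
    have hb : z + z - y ∈ (Metric.ball z r)ᶜ ↔ y ∈ (Metric.ball z r)ᶜ := by
      simp only [mem_compl_iff, Metric.mem_ball, dist_eq_norm]
      rw [← norm_neg (y - z)]
      have : z + z - y - z = -(y - z) := by abel
      rw [this]
    by_cases hy : y ∈ (Metric.ball z r)ᶜ
    · rw [hF, indicator_of_mem hy, indicator_of_mem (hb.2 hy), sideSign_reflect, kernelAt_reflect,
        neg_mul]
    · rw [hF, indicator_of_notMem hy, indicator_of_notMem (fun h => hy (hb.1 h)), neg_zero]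
  have h2 := integral_sub_left_eq_self F volume (z + z)
  simp only [h1, integral_neg] at h2
  linarith

/-- The nonlocal curvature at `z` of a curve that the segment from `z` to `y` crosses an odd number
of times if and only if `y` is in `O`, up to null sets. -/
noncomputable def curvatureIntegral (σ : ℝ) (z u : Plane) (O : Set Plane) : ℝ :=
  -∫ y in O, sideSign z u y * kernelAt σ z y

theorem hasPrincipalValue_curvatureIntegral {σ : ℝ} (hσ : 0 < σ) {A O : Set Plane} {z : Plane}
    (u : Plane) (hO : NullMeasurableSet O) (hint : IntegrableOn (kernelAt σ z) O)
    (hAO : ∀ᵐ y, (z, y) ∈ oddPairs A ↔ y ∈ O) :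
    HasPrincipalValue σ A z u (curvatureIntegral σ z u O) := by
  classical
  set g := fun y => sideSign z u y * kernelAt σ z y with hg
  have hgO : Integrable (O.indicator g) :=
    IntegrableOn.integrable_indicator₀ (integrableOn_sideSign_mul u hint) hO
  have hgB : ∀ r > 0, IntegrableOn g (Metric.ball z r)ᶜ := fun r hr =>
    integrableOn_sideSign_mul u (integrableOn_kernelAt_compl_ball hσ z hr)
  have hae : ∀ᵐ y, chiHat A z u y / ‖z - y‖ ^ (2 + σ) = g y - 2 * O.indicator g y := by
    filter_upwards [hAO] with y hy
    rw [chiHat_eq, div_eq_mul_inv]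
    by_cases h : y ∈ O
    · simp only [hy.2 h, if_true, indicator_of_mem h, hg, kernelAt]; ring
    · rw [if_neg fun h' => h (hy.1 h'), indicator_of_notMem h, hg]; simp only [kernelAt]; ring
  have hval : ∀ r > 0, (1 / 2) * ∫ y in (Metric.ball z r)ᶜ, chiHat A z u y / ‖z - y‖ ^ (2 + σ) =
      -∫ y, (Metric.ball z r)ᶜ.indicator (O.indicator g) y := by
    intro r hr
    rw [integral_congr_ae (ae_restrict_of_ae hae), integral_sub (hgB r hr)
      (hgO.integrableOn.const_mul 2), integral_const_mul,
      setIntegral_sideSign_mul_kernelAt_compl_ball,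
      integral_indicator Metric.isOpen_ball.measurableSet.compl]
    ring
  constructor
  · intro r hr
    exact (Integrable.sub (hgB r hr) (hgO.integrableOn.const_mul 2)).congr
      (ae_restrict_of_ae (hae.mono fun y hy => hy.symm))
  · have hlim : Tendsto (fun r : ℝ => -∫ y, (Metric.ball z r)ᶜ.indicator (O.indicator g) y)
        (𝓝[>] 0) (𝓝 (-∫ y, O.indicator g y)) := by
      refine Tendsto.neg (tendsto_integral_filter_of_dominated_convergence
        (fun y => ‖O.indicator g y‖) (Eventually.of_forall fun r => ?_)
        (Eventually.of_forall fun r => Eventually.of_forall fun y =>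
          norm_indicator_le_norm_self _ _)
        hgO.norm ?_)
      · exact hgO.aestronglyMeasurable.indicator Metric.isOpen_ball.measurableSet.compl
      · filter_upwards [Measure.ae_ne volume z] with y hy
        refine tendsto_const_nhds.congr' ?_
        filter_upwards [Ioo_mem_nhdsGT (dist_pos.2 hy)] with r hr
        have : y ∈ (Metric.ball z r)ᶜ := by simpa using hr.2.le
        rw [indicator_of_mem this]
    rw [integral_indicator₀ hO] at hlim
    exact hlim.congr' (by
      filter_upwards [self_mem_nhdsWithin] with r hr using (hval r hr).symm)

/-- The set `A` has a nonlocal curvature at `z` as soon as almost every segment from `z` is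
transversal to `A` and the kernel is integrable where the number of intersections is odd. The
segment that the definition adds to `A` if `z ∉ A` lies on the line through `z` orthogonal to `u`,
so that the segments from `z` to points off this line do not meet it. -/
theorem hasNonlocalCurvature_curvatureIntegral {σ : ℝ} (hσ : 0 < σ) {A : Set Plane} {z u : Plane}
    (hu : ‖u‖ = 1) (hO : NullMeasurableSet (oddSet A z))
    (hint : IntegrableOn (kernelAt σ z) (oddSet A z)) (htr : ∀ᵐ y, IsTransversal A z y)
    (hzu : z ∈ A → IsNormalAt A z u) :
    HasNonlocalCurvature σ A z u (curvatureIntegral σ z u (oddSet A z)) := by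
  by_cases hz : z ∈ A
  · refine Or.inl ⟨hz, hzu hz, hasPrincipalValue_curvatureIntegral hσ u hO hint ?_⟩
    filter_upwards [htr] with y hy
    exact ⟨fun h => h.2, fun h => ⟨hy, h⟩⟩
  · refine Or.inr ⟨hz, fun _ => curvatureIntegral σ z u (oddSet A z),
      Eventually.of_forall fun δ => hasPrincipalValue_curvatureIntegral hσ u hO hint ?_,
      tendsto_const_nhds⟩
    have hu0 : u ≠ 0 := by rintro rfl; simp at hu
    set L := segment ℝ (z - δ • perp u) (z + δ • perp u)
    have hL : ∀ p ∈ L, inner ℝ (p - z) u = 0 := by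
      intro p hp
      obtain ⟨s, -, rfl⟩ := mem_segment_iff.1 hp
      have h0 : inner ℝ (perp u) u = 0 := by
        simp [perp, PiLp.inner_apply, Fin.sum_univ_two]; ring
      have : z - δ • perp u + s • (z + δ • perp u - (z - δ • perp u)) - z =
          (2 * s * δ - δ) • perp u := by module
      rw [this, inner_smul_left, h0, mul_zero]
    have hLc : IsClosed L := isClosed_segment _ _
    filter_upwards [htr, ae_inner_sub_ne_zero z hu0] with y hy hyu
    have hoff : ∀ p ∈ openSegment ℝ z y, p ∉ L := by
      intro p hp hpL
      obtain ⟨s, hs, rfl⟩ := mem_openSegment_iff.1 hp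
      have := hL _ hpL
      rw [add_sub_cancel_left, inner_smul_left, ← neg_sub z y, inner_neg_left] at this
      simp only [conj_trivial, mul_neg, neg_eq_zero, mul_eq_zero] at this
      exact this.elim hs.1.ne' hyu
    have hinter : (A ∪ L) ∩ openSegment ℝ z y = A ∩ openSegment ℝ z y := by
      ext p
      constructor
      · rintro ⟨hp | hp, hp'⟩
        · exact ⟨hp, hp'⟩
        · exact absurd hp (hoff p hp')
      · exact fun hp => ⟨Or.inl hp.1, hp.2⟩
    have htr' : IsTransversal (A ∪ L) z y := by
      intro p hp
      rw [hinter] at hp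
      have hn : 𝓝[A ∪ L] p = 𝓝[A] p := by
        have hLb : 𝓝[L] p = ⊥ := by
          rw [← notMem_closure_iff_nhdsWithin_eq_bot, hLc.closure_eq]; exact hoff p hp.2
        rw [nhdsWithin_union, hLb, sup_bot_eq]
      rw [tangentConeAt_congr hn]
      exact hy p hp
    constructor
    · rintro ⟨-, h⟩
      simp only [hinter] at h
      exact h
    · intro h
      refine ⟨htr', ?_⟩
      simp only [hinter]
      exact h

/-- Dominated convergence for curvature integrals. -/
theorem tendsto_curvatureIntegral {σ : ℝ} {z : Plane} (u : Plane) {O : ℕ → Set Plane}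
    {O' H : Set Plane} (hO : ∀ n, NullMeasurableSet (O n)) (hH : MeasurableSet H)
    (hint : IntegrableOn (kernelAt σ z) H) (hsub : ∀ᶠ n in atTop, ∀ᵐ y, y ∈ O n → y ∈ H)
    (hlim : ∀ᵐ y, ∀ᶠ n in atTop, y ∈ O n ↔ y ∈ O') :
    NullMeasurableSet O' ∧ IntegrableOn (kernelAt σ z) O' ∧
      Tendsto (fun n => curvatureIntegral σ z u (O n)) atTop
        (𝓝 (curvatureIntegral σ z u O')) := by
  have hO' : NullMeasurableSet O' :=
    nullMeasurableSet_of_tendsto_indicator atTop hO (by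
      filter_upwards [hlim] with y hy using hy)
  have hsub' : ∀ᵐ y, y ∈ O' → y ∈ H := by
    obtain ⟨N, hN⟩ := eventually_atTop.1 hsub
    have : ∀ᵐ y, ∀ n, N ≤ n → y ∈ O n → y ∈ H :=
      ae_all_iff.2 fun n => by
        by_cases hn : N ≤ n
        · filter_upwards [hN n hn] with y hy _ using hy
        · exact Eventually.of_forall fun y h => absurd h hn
    filter_upwards [hlim, this] with y hy1 hy2 hy3
    obtain ⟨n, hn1, hn2⟩ := (hy1.and (eventually_ge_atTop N)).exists
    exact hy2 n hn2 (hn1.2 hy3)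
  refine ⟨hO', hint.mono_set_ae hsub', ?_⟩
  set g := fun y => sideSign z u y * kernelAt σ z y with hg
  have hgm : Measurable g := (measurable_sideSign z u).mul (measurable_kernelAt σ z)
  have hbound : Integrable (fun y => ‖H.indicator g y‖) :=
    ((integrable_indicator_iff hH).2 (integrableOn_sideSign_mul u hint)).norm
  have key : Tendsto (fun n => ∫ y, (O n).indicator g y) atTop (𝓝 (∫ y, O'.indicator g y)) := by
    refine tendsto_integral_filter_of_dominated_convergence (fun y => ‖H.indicator g y‖)
      (Eventually.of_forall fun n => hgm.aestronglyMeasurable.indicator₀ (hO n)) ?_ hbound ?_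
    · filter_upwards [hsub] with n hn
      filter_upwards [hn] with y hy
      by_cases h : y ∈ O n
      · rw [indicator_of_mem h, indicator_of_mem (hy h)]
      · rw [indicator_of_notMem h, norm_zero]; positivity
    · filter_upwards [hlim] with y hy
      refine tendsto_const_nhds.congr' ?_
      filter_upwards [hy] with n hn
      by_cases h : y ∈ O'
      · rw [indicator_of_mem h, indicator_of_mem (hn.2 h)]
      · rw [indicator_of_notMem h, indicator_of_notMem (fun h' => h (hn.1 h'))]
  have h1 : ∀ n, curvatureIntegral σ z u (O n) = -∫ y, (O n).indicator g y := fun n => by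
    rw [curvatureIntegral, integral_indicator₀ (hO n)]
  have h2 : curvatureIntegral σ z u O' = -∫ y, O'.indicator g y := by
    rw [curvatureIntegral, integral_indicator₀ hO']
  simp only [h1, h2]
  exact key.neg

/-! ### Integrability of the kernel on thin cusps -/

theorem volume_box_le (b c : ℝ) :
    volume {w : Plane | |w 0| ≤ b ∧ |w 1| ≤ c} ≤
      ENNReal.ofReal (2 * b) * ENNReal.ofReal (2 * c) := by
  have h := (PiLp.volume_preserving_ofLp (Fin 2)).measure_preimage
    (measurableSet_Icc (a := ![-b, -c]) (b := ![b, c])).nullMeasurableSet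
  rw [Real.volume_Icc_pi, Fin.prod_univ_two] at h
  refine le_of_eq_of_le (congrArg _ ?_) (h.trans_le ?_)
  · ext w
    simp only [mem_ofPred_eq, abs_le, mem_preimage, mem_Icc, Pi.le_def, Fin.forall_fin_two]
    simp; tauto
  · apply le_of_eq
    simp only [Matrix.cons_val_zero, Matrix.cons_val_one]
    congr 2 <;> ring

/-- The intersection of a disc of radius `r` with a strip of width `e` has area `O(r * e)`. -/
theorem exists_volume_strip_le (z : Plane) {d : Plane} (hd : d ≠ 0) :
    ∃ K : ℝ, 0 ≤ K ∧ ∀ r e : ℝ, 0 ≤ r → 0 ≤ e →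
      volume {y : Plane | ‖y - z‖ ≤ r ∧ |planeDet d (y - z)| ≤ e} ≤ ENNReal.ofReal (K * r * e) := by
  have hn : 0 < ‖d‖ := norm_pos_iff.2 hd
  -- the strip is the image of a box under the map with columns `d` and `perp d`
  let B : Plane →ₗ[ℝ] Plane :=
    LinearMap.smulRight (EuclideanSpace.proj (𝕜 := ℝ) (0 : Fin 2) : Plane →L[ℝ] ℝ).toLinearMap d +
    LinearMap.smulRight (EuclideanSpace.proj (𝕜 := ℝ) (1 : Fin 2) : Plane →L[ℝ] ℝ).toLinearMap
      (perp d)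
  have hB : ∀ w : Plane, B w = w 0 • d + w 1 • perp d := fun w => by simp [B]
  refine ⟨|LinearMap.det B| * (4 / ‖d‖ ^ 3), by positivity, fun r e hr he => ?_⟩
  have hsub : {y : Plane | ‖y - z‖ ≤ r ∧ |planeDet d (y - z)| ≤ e} ⊆
      (fun y => y - z) ⁻¹' (B '' {w : Plane | |w 0| ≤ r / ‖d‖ ∧ |w 1| ≤ e / ‖d‖ ^ 2}) := by
    rintro y ⟨h1, h2⟩
    have hdec := normSq_smul_eq d (y - z)
    refine ⟨!₂[inner ℝ d (y - z) / ‖d‖ ^ 2, -planeDet d (y - z) / ‖d‖ ^ 2], ⟨?_, ?_⟩, ?_⟩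
    · have h3 := abs_real_inner_le_norm d (y - z)
      simp only [Matrix.cons_val_zero]
      rw [abs_div, abs_of_pos (by positivity : 0 < ‖d‖ ^ 2), div_le_div_iff₀ (by positivity) hn]
      calc |inner ℝ d (y - z)| * ‖d‖ ≤ (‖d‖ * ‖y - z‖) * ‖d‖ := by gcongr
        _ ≤ (‖d‖ * r) * ‖d‖ := by gcongr
        _ = r * ‖d‖ ^ 2 := by ring
    · simp only [Matrix.cons_val_one, Matrix.cons_val_zero]
      rw [abs_div, abs_neg, abs_of_pos (by positivity : 0 < ‖d‖ ^ 2)]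
      gcongr
    · rw [hB]
      simp only [Matrix.cons_val_one, Matrix.cons_val_zero]
      rw [div_eq_inv_mul, div_eq_inv_mul, mul_smul, mul_smul, ← smul_add, neg_smul,
        ← sub_eq_add_neg, ← hdec, smul_smul, inv_mul_cancel₀ (by positivity), one_smul]
  calc volume {y : Plane | ‖y - z‖ ≤ r ∧ |planeDet d (y - z)| ≤ e}
      ≤ volume ((fun y => y - z) ⁻¹'
          (B '' {w : Plane | |w 0| ≤ r / ‖d‖ ∧ |w 1| ≤ e / ‖d‖ ^ 2})) := measure_mono hsub
    _ = volume (B '' {w : Plane | |w 0| ≤ r / ‖d‖ ∧ |w 1| ≤ e / ‖d‖ ^ 2}) := by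
        simp only [sub_eq_add_neg]
        exact measure_preimage_add_right _ _ _
    _ ≤ ENNReal.ofReal |LinearMap.det B| *
          (ENNReal.ofReal (2 * (r / ‖d‖)) * ENNReal.ofReal (2 * (e / ‖d‖ ^ 2))) := by
        rw [Measure.addHaar_image_linearMap]
        gcongr
        exact volume_box_le _ _
    _ = ENNReal.ofReal (|LinearMap.det B| * (4 / ‖d‖ ^ 3) * r * e) := by
        rw [← ENNReal.ofReal_mul (by positivity), ← ENNReal.ofReal_mul (by positivity)]
        congr 1
        field_simp
        ring

/-- The part in the disc of radius `ρ` about `z` of the cusp of order `1 + a` about the line through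
`z` in the direction `d`. -/
def thinCusp (a M ρ : ℝ) (z d : Plane) : Set Plane :=
  {y | ‖y - z‖ < ρ ∧ |planeDet d (y - z)| ≤ M * ‖y - z‖ ^ (1 + a)}

theorem measurableSet_thinCusp (a M ρ : ℝ) (z d : Plane) : MeasurableSet (thinCusp a M ρ z d) := by
  unfold thinCusp
  rw [ofPred_and]
  refine (measurableSet_lt (by fun_prop) measurable_const).inter (measurableSet_le ?_ ?_)
  · have : Continuous fun y : Plane => |planeDet d (y - z)| := by fun_prop
    exact this.measurable
  · fun_prop

/-- The kernel of order `2 + σ` is integrable on a cusp of order `1 + a > 1 + σ`: the part of the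
cusp where it exceeds `t` has area `O(t ^ (-(2 + a) / (2 + σ)))`. -/
theorem integrableOn_kernelAt_thinCusp {σ a : ℝ} (hσ : 0 < σ) (ha : σ < a) {M : ℝ} (hM : 0 ≤ M)
    (ρ : ℝ) (z : Plane) {d : Plane} (hd : d ≠ 0) :
    IntegrableOn (kernelAt σ z) (thinCusp a M ρ z d) := by
  obtain ⟨K, hK, hvol⟩ := exists_volume_strip_le z hd
  set T := thinCusp a M ρ z d
  refine ⟨(measurable_kernelAt σ z).aestronglyMeasurable, ?_⟩
  rw [hasFiniteIntegral_iff_ofReal (Eventually.of_forall fun y => kernelAt_nonneg σ z y),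
    lintegral_eq_lintegral_meas_le _ (Eventually.of_forall fun y => kernelAt_nonneg σ z y)
      (measurable_kernelAt σ z).aemeasurable, ← Ioc_union_Ioi_eq_Ioi zero_le_one]
  refine (lintegral_union_le _ _ _).trans_lt (ENNReal.add_lt_top.2 ⟨?_, ?_⟩)
  · have hT : volume T < ⊤ := by
      refine (measure_mono (t := Metric.ball z ρ) fun y hy => ?_).trans_lt measure_ball_lt_top
      rw [Metric.mem_ball, dist_eq_norm]; exact hy.1
    calc ∫⁻ t in Ioc (0 : ℝ) 1, (volume.restrict T) {y | t ≤ kernelAt σ z y}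
        ≤ ∫⁻ _ in Ioc (0 : ℝ) 1, volume T := lintegral_mono fun t => by
          rw [← Measure.restrict_apply_univ T]
          exact measure_mono (subset_univ _)
      _ < ⊤ := by simp [hT]
  · set q : ℝ := (2 + a) / (2 + σ) with hq
    have hq1 : 1 < q := by rw [hq, one_lt_div (by linarith)]; linarith
    have hle : ∀ t ∈ Ioi (1 : ℝ), (volume.restrict T) {y | t ≤ kernelAt σ z y} ≤
        ENNReal.ofReal (K * M * t ^ (-q)) := by
      intro t ht
      have ht0 : (0 : ℝ) < t := zero_lt_one.trans ht
      set r : ℝ := t ^ (-(2 + σ)⁻¹) with hr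
      have hr0 : 0 < r := by positivity
      have hsub : {y | t ≤ kernelAt σ z y} ∩ T ⊆
          {y : Plane | ‖y - z‖ ≤ r ∧ |planeDet d (y - z)| ≤ M * r ^ (1 + a)} := by
        rintro y ⟨hy, hyT⟩
        have hyr : ‖y - z‖ ≤ r := by
          rw [mem_ofPred_eq, kernelAt, norm_sub_rev] at hy
          have hpos : 0 < (‖y - z‖ ^ (2 + σ))⁻¹ := ht0.trans_le hy
          rw [inv_pos] at hpos
          have h1 : ‖y - z‖ ^ (2 + σ) ≤ t⁻¹ := (le_inv_comm₀ ht0 hpos).1 hy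
          have h2 := Real.rpow_le_rpow hpos.le h1 (by positivity : 0 ≤ (2 + σ)⁻¹)
          rwa [Real.rpow_rpow_inv (norm_nonneg _) (by linarith), Real.inv_rpow ht0.le,
            ← Real.rpow_neg ht0.le] at h2
        refine ⟨hyr, hyT.2.trans ?_⟩
        gcongr
        linarith
      rw [Measure.restrict_apply (measurableSet_le measurable_const (measurable_kernelAt σ z))]
      refine (measure_mono hsub).trans ((hvol _ _ hr0.le (by positivity)).trans_eq ?_)
      congr 1
      have : r * r ^ (1 + a) = t ^ (-q) := by
        rw [← Real.rpow_one_add' hr0.le (by linarith), hr, ← Real.rpow_mul ht0.le]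
        congr 1
        rw [hq]; field_simp; ring
      rw [← this]; ring
    refine (setLIntegral_mono' measurableSet_Ioi hle).trans_lt ?_
    have hint := (integrableOn_Ioi_rpow_of_lt (by linarith : -q < -1) zero_lt_one).const_mul (K * M)
    have := (hasFiniteIntegral_iff_ofReal ?_).1 hint.2
    · exact this
    · filter_upwards [ae_restrict_mem measurableSet_Ioi] with t ht
      have ht0 : (0 : ℝ) < t := zero_lt_one.trans ht
      simp only [Pi.zero_apply]
      positivity

/-! ### Regular arcs and almost every segment -/

/-- `γ'` is a continuous and nowhere vanishing derivative of `γ` on `[α, β]`, where `α < β`. -/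
structure IsRegularArc (γ γ' : ℝ → Plane) (α β : ℝ) : Prop where
  lt : α < β
  hasDeriv : ∀ t ∈ Icc α β, HasDerivWithinAt γ (γ' t) (Icc α β) t
  continuousOn_deriv : ContinuousOn γ' (Icc α β)
  deriv_ne : ∀ t ∈ Icc α β, γ' t ≠ 0

namespace IsRegularArc

variable {γ γ' : ℝ → Plane} {α β : ℝ}

theorem continuousOn (h : IsRegularArc γ γ' α β) : ContinuousOn γ (Icc α β) := fun t ht =>
  (h.hasDeriv t ht).continuousWithinAt

theorem isCompact_image (h : IsRegularArc γ γ' α β) : IsCompact (γ '' Icc α β) :=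
  isCompact_Icc.image_of_continuousOn h.continuousOn

theorem mono (h : IsRegularArc γ γ' α β) {c d : ℝ} (hcd : c < d) (hsub : Icc c d ⊆ Icc α β) :
    IsRegularArc γ γ' c d :=
  ⟨hcd, fun t ht => (h.hasDeriv t (hsub ht)).mono hsub, h.continuousOn_deriv.mono hsub,
    fun t ht => h.deriv_ne t (hsub ht)⟩

theorem isBigO_sub (h : IsRegularArc γ γ' α β) {t : ℝ} (ht : t ∈ Icc α β) :
    (fun s => s - t) =O[𝓝[Icc α β] t] fun s => γ s - γ t := by
  have h1 := (HasDerivAtFilter.isTheta_sub (h.hasDeriv t ht) (h.deriv_ne t ht)).isBigO_symm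
  exact h1.comp_tendsto (tendsto_id.prodMk tendsto_const_pure)

end IsRegularArc

theorem volume_image_eq_zero_of_degenerate {f : Plane → Plane} {f' : Plane → Plane →L[ℝ] Plane}
    {s : Set Plane} (hf : ∀ x ∈ s, HasFDerivWithinAt f (f' x) s x)
    (hdeg : ∀ x ∈ s, ∃ v ≠ 0, f' x v = 0) : volume (f '' s) = 0 := by
  refine addHaar_image_eq_zero_of_det_fderivWithin_eq_zero volume hf fun x hx => ?_
  obtain ⟨v, hv, hfv⟩ := hdeg x hx
  by_contra hdet
  have hinj : Function.Injective (f' x : Plane →ₗ[ℝ] Plane) := by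
    rw [← LinearMap.ker_eq_bot]
    by_contra hk
    exact hdet (LinearMap.det_eq_zero_iff_ker_ne_bot.2 hk)
  exact hv (hinj (by simpa using hfv))

/-- The closed segment from `z` to `y` is nowhere parallel to the arc at a common point, contains no
endpoint of the arc other than `z`, and does not end on the arc. -/
def IsGenericFor (z : Plane) (γ γ' : ℝ → Plane) (α β : ℝ) (y : Plane) : Prop :=
  ∀ t ∈ Icc α β, γ t ∈ segment ℝ z y →
    planeDet (y - z) (γ' t) ≠ 0 ∧ (γ t ≠ z → t ∈ Ioo α β) ∧ γ t ≠ y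

/-- Sard's theorem for the central projection from `z`: the points `y` that are seen from `z` in the
direction of a point of tangency are critical values of `(r, t) ↦ z + r (γ t - z)`. The tangent
line at `z` itself is missed by this map; as the arc passes through `z` at most at its ends, there
are at most two such lines. -/
theorem IsRegularArc.ae_isGenericFor (z : Plane) {γ γ' : ℝ → Plane} {α β : ℝ}
    (h : IsRegularArc γ γ' α β)
    (hz : ∀ t ∈ Ioo α β, γ t ≠ z) : ∀ᵐ y, IsGenericFor z γ γ' α β y := by
  have hα : α ∈ Icc α β := left_mem_Icc.2 h.lt.le
  have hβ : β ∈ Icc α β := right_mem_Icc.2 h.lt.le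
  have hproj : ∀ (S : Set Plane) (w : Plane) (i : Fin 2), HasFDerivWithinAt (fun w : Plane => w i)
      (EuclideanSpace.proj i : Plane →L[ℝ] ℝ) S w := fun S w i =>
    (EuclideanSpace.proj i : Plane →L[ℝ] ℝ).hasFDerivWithinAt
  have hcomp : ∀ S : Set Plane, (∀ w ∈ S, w 1 ∈ Icc α β) → ∀ w ∈ S,
      HasFDerivWithinAt (fun w : Plane => γ (w 1))
        ((ContinuousLinearMap.toSpanSingleton ℝ (γ' (w 1))).comp
          (EuclideanSpace.proj 1 : Plane →L[ℝ] ℝ)) S w := fun S hS w hw =>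
    (h.hasDeriv _ (hS w hw)).hasFDerivWithinAt.comp w (hproj S w 1) hS
  -- the points whose direction from `z` is tangent to the arc
  have h1 : volume ((fun w : Plane => z + w 0 • (γ (w 1) - z)) ''
      {w | w 1 ∈ Icc α β ∧ planeDet (γ (w 1) - z) (γ' (w 1)) = 0 ∧ γ (w 1) ≠ z}) = 0 := by
    set S := {w : Plane | w 1 ∈ Icc α β ∧ planeDet (γ (w 1) - z) (γ' (w 1)) = 0 ∧ γ (w 1) ≠ z}
    refine volume_image_eq_zero_of_degenerate (fun w hw => (((hproj S w 0).smul
      ((hcomp S (fun w hw => hw.1) w hw).sub_const z)).const_add z)) fun w hw => ?_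
    obtain ⟨c, hc⟩ := exists_smul_of_planeDet_eq_zero (sub_ne_zero.2 hw.2.2) hw.2.1
    refine ⟨!₂[-(w 0 * c), 1], fun h0 => ?_, ?_⟩
    · have := congrArg (fun v : Plane => v 1) h0
      simp at this
    · simp [hc]
      module
  -- the arc itself
  have h2 : volume ((fun w : Plane => γ (w 1)) '' {w | w 1 ∈ Icc α β}) = 0 := by
    refine volume_image_eq_zero_of_degenerate (fun w hw => hcomp _ (fun w hw => hw) w hw)
      fun w hw => ⟨!₂[1, 0], fun h0 => ?_, ?_⟩
    · have := congrArg (fun v : Plane => v 0) h0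
      simp at this
    · simp
  have hline : ∀ v : Plane, ∀ᵐ y, v ≠ 0 → planeDet v (y - z) ≠ 0 := by
    intro v
    by_cases hv : v = 0
    · exact Eventually.of_forall fun y hy => absurd hv hy
    · filter_upwards [ae_planeDet_sub_ne_zero z hv] with y hy _ using hy
  filter_upwards [measure_eq_zero_iff_ae_notMem.1 h1, measure_eq_zero_iff_ae_notMem.1 h2,
    hline (γ α - z), hline (γ β - z), hline (γ' α), hline (γ' β)] with y hy1 hy2 hy3 hy4 hy5 hy6
  intro t ht hty
  obtain ⟨s, hs, hst⟩ := mem_segment_iff.1 hty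
  have hst' : γ t - z = s • (y - z) := by rw [hst]; abel
  have hends : t ∉ Ioo α β → t = α ∨ t = β := by
    intro hnt
    rcases ht.1.eq_or_lt with h' | h'
    · exact Or.inl h'.symm
    · rcases ht.2.eq_or_lt with h'' | h''
      · exact Or.inr h''
      · exact absurd ⟨h', h''⟩ hnt
  refine ⟨fun h0 => ?_, fun hne => ?_, fun hne => hy2 ⟨!₂[0, t], ht, by simpa using hne⟩⟩
  · by_cases hne : γ t = z
    · rw [planeDet_swap, neg_eq_zero] at h0
      rcases hends (fun h' => hz t h' hne) with rfl | rfl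
      · exact hy5 (h.deriv_ne _ hα) h0
      · exact hy6 (h.deriv_ne _ hβ) h0
    · have hs0 : s ≠ 0 := by
        rintro rfl
        exact hne (by simpa using hst)
      refine hy1 ⟨!₂[s⁻¹, t], ⟨ht, ?_, hne⟩, ?_⟩
      · change planeDet (γ t - z) (γ' t) = 0
        rw [hst', planeDet_swap, map_smul, planeDet_swap, h0]; simp
      · change z + s⁻¹ • (γ t - z) = y
        rw [hst', smul_smul, inv_mul_cancel₀ hs0, one_smul, add_sub_cancel]
  · by_contra hnt
    have h0 : planeDet (γ t - z) (y - z) = 0 := by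
      rw [hst', planeDet_swap, map_smul, planeDet_self, smul_zero, neg_zero]
    rcases hends hnt with rfl | rfl
    · exact hy3 (sub_ne_zero.2 hne) h0
    · exact hy4 (sub_ne_zero.2 hne) h0

theorem IsRegularArc.hasDerivWithinAt_planeDet {γ γ' : ℝ → Plane} {α β : ℝ}
    (h : IsRegularArc γ γ' α β) (v z : Plane) {t : ℝ} (ht : t ∈ Icc α β) :
    HasDerivWithinAt (fun s => planeDet v (γ s - z)) (planeDet v (γ' t)) (Icc α β) t :=
  (planeDet v).hasFDerivAt.comp_hasDerivWithinAt t ((h.hasDeriv t ht).sub_const z)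

/-- Transversal crossings are isolated, so that an arc has finitely many of them. -/
theorem IsGenericFor.finite {z y : Plane} {γ γ' : ℝ → Plane} {α β : ℝ} (h : IsRegularArc γ γ' α β)
    (hy : IsGenericFor z γ γ' α β y) : {t ∈ Icc α β | γ t ∈ segment ℝ z y}.Finite := by
  have key : ({t | γ t ∈ segment ℝ z y} ∩ Icc α β).Finite := by
    refine isCompact_Icc.induction_on (p := fun U => ({t | γ t ∈ segment ℝ z y} ∩ U).Finite)
      (by simp) (fun s t hst ht => ht.subset (inter_subset_inter_right _ hst))
      (fun s t hs ht => by rw [inter_union_distrib_left]; exact hs.union ht) fun t ht => ?_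
    have hev : ∀ᶠ s in 𝓝[Icc α β \ {t}] t, γ s ∉ segment ℝ z y := by
      by_cases hty : γ t ∈ segment ℝ z y
      · filter_upwards [(h.hasDerivWithinAt_planeDet (y - z) z ht).eventually_ne (c := 0)
          (hy t ht hty).1] with s hs hs'
        exact hs (planeDet_sub_eq_zero_of_mem_segment hs')
      · exact ((h.continuousOn t ht).mono sdiff_subset).eventually_mem
          ((isClosed_segment z y).isOpen_compl.mem_nhds hty)
    have hev' : ∀ᶠ s in 𝓝[Icc α β] t, s ≠ t → γ s ∉ segment ℝ z y := by
      have : Icc α β \ {t} = Icc α β ∩ {t}ᶜ := rfl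
      rw [this, nhdsWithin_inter', eventually_inf_principal] at hev
      exact hev
    exact ⟨_, hev', (finite_singleton t).subset fun s hs => by
      by_contra hne
      exact hs.2 hne hs.1⟩
  refine key.subset fun t ht => ⟨ht.2, ht.1⟩

/-- If a set coincides with the arc near `γ t`, its tangent cone there lies in the tangent line. -/
theorem IsRegularArc.planeDet_eq_zero_of_mem_tangentConeAt {γ γ' : ℝ → Plane} {α β : ℝ}
    (h : IsRegularArc γ γ' α β) {t : ℝ} (ht : t ∈ Icc α β) {A : Set Plane}
    (hA : 𝓝[A] (γ t) ≤ map γ (𝓝[Icc α β] t)) {v : Plane} (hv : v ∈ tangentConeAt ℝ A (γ t)) :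
    planeDet (γ' t) v = 0 := by
  -- the functional `planeDet (γ' t)` has its own differential and `0` as derivatives within `A`
  have h1 : HasFDerivWithinAt (planeDet (γ' t)) (planeDet (γ' t)) A (γ t) :=
    (planeDet (γ' t)).hasFDerivWithinAt
  have h2 : HasFDerivWithinAt (planeDet (γ' t)) (0 : Plane →L[ℝ] ℝ) A (γ t) := by
    rw [hasFDerivWithinAt_iff_isLittleO]
    refine Asymptotics.IsLittleO.mono ?_ hA
    rw [Asymptotics.isLittleO_map]
    have h3 := h.hasDerivWithinAt_planeDet (γ' t) 0 ht
    rw [planeDet_self, hasDerivWithinAt_iff_isLittleO] at h3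
    simp only [sub_zero, smul_zero] at h3
    refine (Asymptotics.IsLittleO.trans_isBigO h3 (h.isBigO_sub ht)).congr_left fun s => ?_
    simp
  exact h1.unique_on h2 hv

/-- A point of a compact arc that is passed once has neighborhoods in the arc that come from
neighborhoods of its parameter. -/
theorem nhdsWithin_image_le_map {γ : ℝ → Plane} {α β t : ℝ} (hγ : ContinuousOn γ (Icc α β))
    (huniq : ∀ s ∈ Icc α β, γ s = γ t → s = t) :
    𝓝[γ '' Icc α β] (γ t) ≤ map γ (𝓝[Icc α β] t) := by
  intro U hU
  obtain ⟨V, hVo, htV, hV⟩ := mem_nhdsWithin.1 (mem_map.1 hU)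
  have hK : IsCompact (γ '' (Icc α β \ V)) :=
    (isCompact_Icc.diff hVo).image_of_continuousOn (hγ.mono sdiff_subset)
  have hmem : γ t ∈ (γ '' (Icc α β \ V))ᶜ := by
    rintro ⟨s, hs, hst⟩
    exact hs.2 (huniq s hs.1 hst ▸ htV)
  refine mem_nhdsWithin.2 ⟨_, hK.isClosed.isOpen_compl, hmem, ?_⟩
  rintro _ ⟨hq, s, hs, rfl⟩
  by_cases hsV : s ∈ V
  · exact hV ⟨hsV, hs⟩
  · exact absurd ⟨s, ⟨hs, hsV⟩, rfl⟩ hq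

/-! ### The set of points hidden by a curve -/

/-- The points that are hidden from `z` by `A` lie in a measurable set over which the kernel is
integrable. -/
def HasIntegrableShadow (σ : ℝ) (z : Plane) (A : Set Plane) : Prop :=
  ∃ H, MeasurableSet H ∧ IntegrableOn (kernelAt σ z) H ∧
    ∀ y ≠ z, (A ∩ openSegment ℝ z y).Nonempty → y ∈ H

namespace HasIntegrableShadow

variable {σ : ℝ} {z : Plane} {A B : Set Plane}

theorem mono (hAB : A ⊆ B) (h : HasIntegrableShadow σ z B) : HasIntegrableShadow σ z A := by
  obtain ⟨H, h1, h2, h3⟩ := h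
  exact ⟨H, h1, h2, fun y hy hne => h3 y hy (hne.mono (inter_subset_inter_left _ hAB))⟩

theorem union (hA : HasIntegrableShadow σ z A) (hB : HasIntegrableShadow σ z B) :
    HasIntegrableShadow σ z (A ∪ B) := by
  obtain ⟨H, h1, h2, h3⟩ := hA
  obtain ⟨H', h1', h2', h3'⟩ := hB
  refine ⟨H ∪ H', h1.union h1', h2.union h2', fun y hy hne => ?_⟩
  rw [union_inter_distrib_right, union_nonempty] at hne
  exact hne.imp (h3 y hy) (h3' y hy)

theorem of_disjoint_ball (hσ : 0 < σ) {r : ℝ} (hr : 0 < r) (hA : Disjoint A (Metric.ball z r)) :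
    HasIntegrableShadow σ z A := by
  refine ⟨(Metric.ball z r)ᶜ, Metric.isOpen_ball.measurableSet.compl,
    integrableOn_kernelAt_compl_ball hσ z hr, fun y hy ⟨p, hpA, hp⟩ hyb => ?_⟩
  refine disjoint_left.1 hA hpA ?_
  rw [Metric.mem_ball, dist_eq_norm] at hyb ⊢
  exact (norm_sub_lt_of_mem_openSegment hy hp).trans hyb

theorem empty (hσ : 0 < σ) : HasIntegrableShadow σ z ∅ :=
  of_disjoint_ball hσ one_pos (empty_disjoint _)

theorem biUnion (hσ : 0 < σ) {ι : Type*} {s : Set ι} (hs : s.Finite) {f : ι → Set Plane}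
    (h : ∀ i ∈ s, HasIntegrableShadow σ z (f i)) : HasIntegrableShadow σ z (⋃ i ∈ s, f i) := by
  induction s, hs using Set.Finite.induction_on with
  | empty => simpa using empty hσ
  | insert _ _ ih =>
    rw [biUnion_insert]
    exact (h _ (mem_insert _ _)).union (ih fun i hi => h i (mem_insert_of_mem _ hi))

theorem iUnion_of_locallyFinite (hσ : 0 < σ) {ι : Type*} {f : ι → Set Plane} (hf : LocallyFinite f)
    (h : ∀ i, HasIntegrableShadow σ z (f i)) : HasIntegrableShadow σ z (⋃ i, f i) := by
  have hfin := hf.finite_nonempty_inter_compact (isCompact_closedBall z 1)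
  set s := {i | (f i ∩ Metric.closedBall z 1).Nonempty}
  have hfar : HasIntegrableShadow σ z (⋃ i ∈ sᶜ, f i) := by
    refine of_disjoint_ball hσ one_pos (disjoint_left.2 fun p hp hpb => ?_)
    obtain ⟨i, hi, hpi⟩ := mem_iUnion₂.1 hp
    exact hi ⟨p, hpi, Metric.ball_subset_closedBall hpb⟩
  refine ((biUnion hσ hfin fun i _ => h i).union hfar).mono ?_
  rw [← biUnion_union, union_compl_self, biUnion_univ]

/-- Near `z`, the shadow of an arc of class `C^{1,a}` through `z` lies in a cusp of order `1 + a`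
about the tangent at `z`. -/
theorem of_isRegularArc (hσ : 0 < σ) {a : ℝ} (ha : σ < a) {γ γ' : ℝ → Plane} {α β K : ℝ}
    (h : IsRegularArc γ γ' α β)
    (hK : ∀ s ∈ Icc α β, ∀ t ∈ Icc α β, ‖γ' s - γ' t‖ ≤ K * |s - t| ^ a) :
    HasIntegrableShadow σ z (γ '' Icc α β) := by
  refine isCompact_Icc.induction_on (p := fun U => HasIntegrableShadow σ z (γ '' U))
    (by simpa using empty hσ) (fun s t hst ht => ht.mono (image_mono hst))
    (fun s t hs ht => by rw [image_union]; exact hs.union ht) fun t ht => ?_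
  by_cases hz : γ t = z
  · obtain ⟨c, hc, hO⟩ := (h.isBigO_sub ht).exists_pos
    refine ⟨_, inter_mem hO.bound self_mem_nhdsWithin, ?_⟩
    set M : ℝ := ‖γ' t‖ * |K| * c ^ (1 + a) with hM
    have hM0 : 0 ≤ M := by positivity
    refine ⟨thinCusp a M 1 z (γ' t) ∪ (Metric.ball z 1)ᶜ, (measurableSet_thinCusp _ _ _ _ _).union
      Metric.isOpen_ball.measurableSet.compl, (integrableOn_kernelAt_thinCusp hσ ha hM0 1 z
      (h.deriv_ne t ht)).union (integrableOn_kernelAt_compl_ball hσ z one_pos), ?_⟩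
    rintro y hy ⟨_, ⟨s, ⟨hs1, hs2⟩, rfl⟩, hsy⟩
    by_cases hyb : y ∈ Metric.ball z 1
    swap
    · exact Or.inr hyb
    refine Or.inl ⟨by rwa [Metric.mem_ball, dist_eq_norm] at hyb, ?_⟩
    rw [mem_ofPred_eq, hz, Real.norm_eq_abs] at hs1
    obtain ⟨r, hr, hrs⟩ := mem_openSegment_iff.1 hsy
    have hrs' : γ s - z = r • (y - z) := by rw [hrs]; abel
    have hsub : uIcc t s ⊆ Icc α β := ordConnected_Icc.uIcc_subset ht hs2
    -- the deviation from the tangent, by the mean value inequality and the Hölder condition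
    have hmv : |planeDet (γ' t) (γ s - z)| ≤ ‖γ' t‖ * (|K| * |s - t| ^ a) * |s - t| := by
      have := Convex.norm_image_sub_le_of_norm_hasDerivWithin_le
        (fun x hx => (h.hasDerivWithinAt_planeDet (γ' t) z (hsub hx)).mono hsub)
        (C := ‖γ' t‖ * (|K| * |s - t| ^ a)) (fun x hx => ?_) (convex_uIcc t s)
        left_mem_uIcc right_mem_uIcc
      · simpa [hz] using this
      · have hx1 : |x - t| ≤ |s - t| := by
          have := abs_sub_left_of_mem_uIcc hx
          exact this
        have : planeDet (γ' t) (γ' x) = planeDet (γ' t) (γ' x - γ' t) := by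
          rw [map_sub, planeDet_self, sub_zero]
        rw [this, Real.norm_eq_abs]
        refine (abs_planeDet_le _ _).trans ?_
        gcongr
        refine (hK x (hsub hx) t ht).trans ?_
        gcongr
        · exact le_abs_self K
        · linarith
    have hn0 : 0 ≤ ‖y - z‖ := norm_nonneg _
    rw [hrs', norm_smul, Real.norm_eq_abs, abs_of_pos hr.1] at hs1
    rw [hrs', map_smul, smul_eq_mul, abs_mul, abs_of_pos hr.1] at hmv
    have ha0 : 0 < a := hσ.trans ha
    -- the point `y` is `r⁻¹` times as far from `z` as `γ s`, where `r < 1`, and `r ^ (1 + a) ≤ r`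
    have h3 : |s - t| ^ a * |s - t| ≤ (c * (r * ‖y - z‖)) ^ (1 + a) := by
      rw [← Real.rpow_add_one' (abs_nonneg _) (by linarith), add_comm a 1]
      gcongr
    have h4 : (c * (r * ‖y - z‖)) ^ (1 + a) ≤ c ^ (1 + a) * (r * ‖y - z‖ ^ (1 + a)) := by
      rw [Real.mul_rpow hc.le (by have := hr.1; positivity), Real.mul_rpow hr.1.le hn0]
      gcongr
      exact Real.rpow_le_self_of_le_one hr.1.le hr.2.le (by linarith)
    have h5 : r * |planeDet (γ' t) (y - z)| ≤ r * (M * ‖y - z‖ ^ (1 + a)) := by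
      calc r * |planeDet (γ' t) (y - z)| ≤ ‖γ' t‖ * (|K| * |s - t| ^ a) * |s - t| := hmv
        _ = ‖γ' t‖ * |K| * (|s - t| ^ a * |s - t|) := by ring
        _ ≤ ‖γ' t‖ * |K| * (c ^ (1 + a) * (r * ‖y - z‖ ^ (1 + a))) := by
          exact mul_le_mul_of_nonneg_left (h3.trans h4) (by positivity)
        _ = r * (M * ‖y - z‖ ^ (1 + a)) := by rw [hM]; ring
    exact le_of_mul_le_mul_left h5 hr.1
  · obtain ⟨r, hr⟩ : ∃ r, r = dist (γ t) z / 2 := ⟨_, rfl⟩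
    have hd : 0 < dist (γ t) z := dist_pos.2 hz
    refine ⟨_, (h.continuousOn t ht).eventually_mem (Metric.ball_mem_nhds (γ t) (half_pos hd)), ?_⟩
    refine of_disjoint_ball hσ (half_pos hd) (disjoint_left.2 ?_)
    rintro _ ⟨s, hs, rfl⟩ hs'
    rw [mem_ofPred_eq, Metric.mem_ball] at hs
    rw [Metric.mem_ball] at hs'
    have := dist_triangle_left (γ t) z (γ s)
    linarith

end HasIntegrableShadow

/-! ### Stability of the number of crossings -/

/-- On `[α, β]`, the map `f` is within `ω` of `γ`, and `f - γ` is Lipschitz with constant `ω`. For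
piecewise `C¹` maps this is closeness in the `C¹` norm. -/
structure IsLipschitzClose (f γ : ℝ → Plane) (α β ω : ℝ) : Prop where
  norm_sub_le : ∀ t ∈ Icc α β, ‖f t - γ t‖ ≤ ω
  lipschitz : ∀ s ∈ Icc α β, ∀ t ∈ Icc α β, ‖(f t - γ t) - (f s - γ s)‖ ≤ ω * |t - s|

theorem IsLipschitzClose.continuousOn {f γ : ℝ → Plane} {α β ω : ℝ}
    (h : IsLipschitzClose f γ α β ω) (hγ : ContinuousOn γ (Icc α β)) :
    ContinuousOn f (Icc α β) := by
  have h1 : ContinuousOn (fun t => f t - γ t) (Icc α β) := by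
    refine (LipschitzOnWith.of_dist_le_mul (K := ω.toNNReal) fun t ht s hs => ?_).continuousOn
    rw [dist_eq_norm, Real.dist_eq]
    exact (h.lipschitz s hs t ht).trans (by gcongr; exact Real.le_coe_toNNReal ω)
  exact (h1.add hγ).congr fun t _ => by simp

theorem isLipschitzClose_self (γ : ℝ → Plane) (α β : ℝ) {ω : ℝ} (hω : 0 ≤ ω) :
    IsLipschitzClose γ γ α β ω :=
  ⟨fun t _ => by simpa using hω, fun s _ t _ => by simp; positivity⟩

/-- A transversal crossing of a segment persists, without multiplying, under perturbations of the
arc that are small in the Lipschitz sense. -/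
theorem IsRegularArc.exists_unique_crossing {γ γ' : ℝ → Plane} {α β : ℝ}
    (h : IsRegularArc γ γ' α β) {z y : Plane} (hyz : y ≠ z) {t : ℝ} (ht : t ∈ Ioo α β)
    (hty : γ t ∈ openSegment ℝ z y) (htr : planeDet (y - z) (γ' t) ≠ 0) {V : Set Plane}
    (hV : V ∈ 𝓝 (γ t)) :
    ∃ δ > 0, Icc (t - δ) (t + δ) ⊆ Icc α β ∧ ∀ᶠ ω in 𝓝[>] (0 : ℝ), ∀ f : ℝ → Plane,
      IsLipschitzClose f γ α β ω →
        (∃ s ∈ Icc (t - δ) (t + δ), f s ∈ openSegment ℝ z y ∧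
          ∀ s' ∈ Icc (t - δ) (t + δ), f s' ∈ openSegment ℝ z y → s' = s) ∧
        ∀ s ∈ Icc (t - δ) (t + δ), f s ∈ V := by
  have htI : t ∈ Icc α β := Ioo_subset_Icc_self ht
  set m := planeDet (y - z) (γ' t) with hm
  -- the factor `m` makes `l ∘ γ` increasing at `t`, whatever the sign of `m`
  set l : Plane →L[ℝ] ℝ := m • planeDet (y - z) with hl
  have hl0 : ∀ x, l x = 0 ↔ planeDet (y - z) x = 0 := fun x => by simp [hl, htr]
  have hm0 : 0 < m ^ 2 := by positivity
  -- an open strip in which the segment coincides with its line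
  have hstrip : {p | 0 < inner ℝ (y - z) (p - z) ∧ inner ℝ (y - z) (p - z) < ‖y - z‖ ^ 2} ∈
      𝓝 (γ t) := by
    refine IsOpen.mem_nhds ?_ ((mem_openSegment_iff_planeDet hyz).1 hty).2
    have hc : Continuous fun p : Plane => (inner ℝ (y - z) (p - z) : ℝ) := by fun_prop
    exact (isOpen_lt continuous_const hc).inter (isOpen_lt hc continuous_const)
  obtain ⟨ρ, hρ, hρV⟩ := Metric.mem_nhds_iff.1 (inter_mem hV hstrip)
  have hIcc : Icc α β ∈ 𝓝 t := Icc_mem_nhds ht.1 ht.2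
  have hc1 : ContinuousAt γ t := (h.continuousOn t htI).continuousAt hIcc
  have hc2 : ContinuousAt (fun s => l (γ' s)) t :=
    l.continuous.continuousAt.comp ((h.continuousOn_deriv t htI).continuousAt hIcc)
  have hlt : l (γ' t) = m ^ 2 := by simp [hl, ← hm]; ring
  have hev : ∀ᶠ s in 𝓝 t, s ∈ Icc α β ∧ γ s ∈ Metric.ball (γ t) (ρ / 2) ∧
      dist (l (γ' s)) (l (γ' t)) < m ^ 2 / 2 :=
    (eventually_mem_set.2 hIcc).and ((hc1.eventually_mem (Metric.ball_mem_nhds _ (half_pos hρ))).and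
      (hc2.eventually_mem (Metric.ball_mem_nhds _ (half_pos hm0))))
  obtain ⟨δ, hδ, hball⟩ := Metric.nhds_basis_closedBall.eventually_iff.1 hev
  rw [Real.closedBall_eq_Icc] at hball
  have hsub : Icc (t - δ) (t + δ) ⊆ Icc α β := fun s hs => (hball hs).1
  refine ⟨δ, hδ, hsub, ?_⟩
  have htδ : t ∈ Icc (t - δ) (t + δ) := ⟨by linarith, by linarith⟩
  have hlδ : t - δ ∈ Icc (t - δ) (t + δ) := ⟨by linarith, by linarith⟩
  have hrδ : t + δ ∈ Icc (t - δ) (t + δ) := ⟨by linarith, by linarith⟩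
  have hgrow : ∀ s ∈ Icc (t - δ) (t + δ), ∀ s' ∈ Icc (t - δ) (t + δ),
      |l (γ s') - l (γ s) - m ^ 2 * (s' - s)| ≤ m ^ 2 / 2 * |s' - s| := by
    intro s hs s' hs'
    have hder : ∀ x ∈ Icc (t - δ) (t + δ), HasDerivWithinAt (fun x => l (γ x) - m ^ 2 * x)
        (l (γ' x) - m ^ 2) (Icc (t - δ) (t + δ)) x := fun x hx => by
      have h1 := l.hasFDerivAt.comp_hasDerivWithinAt x ((h.hasDeriv x (hsub hx)).mono hsub)
      have h2 := h1.sub ((hasDerivWithinAt_id x _).const_mul (m ^ 2))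
      rw [mul_one] at h2
      exact h2
    have := Convex.norm_image_sub_le_of_norm_hasDerivWithin_le hder (C := m ^ 2 / 2)
      (fun x hx => by
        have := (hball hx).2.2.le
        rwa [hlt, dist_eq_norm] at this) (convex_Icc _ _) hs hs'
    rw [Real.norm_eq_abs, Real.norm_eq_abs] at this
    convert this using 2
    ring
  have hsmall : ∀ᶠ ω in 𝓝[>] (0 : ℝ),
      ω < ρ / 2 ∧ ‖l‖ * ω < m ^ 2 / 4 ∧ ‖l‖ * ω < m ^ 2 / 4 * δ := by
    have hlim : Tendsto (fun ω : ℝ => ‖l‖ * ω) (𝓝[>] 0) (𝓝 0) := by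
      have : ContinuousAt (fun ω : ℝ => ‖l‖ * ω) 0 := by fun_prop
      simpa using this.tendsto.mono_left nhdsWithin_le_nhds
    exact (eventually_nhdsWithin_of_eventually_nhds (eventually_lt_nhds (half_pos hρ))).and
      ((hlim.eventually_lt_const (by positivity)).and (hlim.eventually_lt_const (by positivity)))
  filter_upwards [hsmall, self_mem_nhdsWithin] with ω hω hω0 f hf
  have hfV : ∀ s ∈ Icc (t - δ) (t + δ), f s ∈ Metric.ball (γ t) ρ := by
    intro s hs
    have h1 := hf.norm_sub_le s (hsub hs)
    have h2 := (hball hs).2.1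
    rw [← dist_eq_norm] at h1
    rw [Metric.mem_ball] at h2 ⊢
    linarith [dist_triangle (f s) (γ s) (γ t), hω.1]
  have hmono : ∀ s ∈ Icc (t - δ) (t + δ), ∀ s' ∈ Icc (t - δ) (t + δ), s ≤ s' →
      m ^ 2 / 4 * (s' - s) ≤ l (f s' - z) - l (f s - z) := by
    intro s hs s' hs' hss
    have h1 := hgrow s hs s' hs'
    have h2 : |l ((f s' - γ s') - (f s - γ s))| ≤ ‖l‖ * (ω * |s' - s|) :=
      (l.le_opNorm _).trans (by gcongr; exact hf.lipschitz s (hsub hs) s' (hsub hs'))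
    rw [abs_of_nonneg (sub_nonneg.2 hss)] at h1 h2
    simp only [map_sub] at h2 ⊢
    have h3 := (abs_le.1 h1).1
    have h4 := (abs_le.1 h2).1
    nlinarith [hω.2.1, sub_nonneg.2 hss]
  have hft : |l (f t - z)| ≤ ‖l‖ * ω := by
    have h1 : l (γ t - z) = 0 := (hl0 _).2 ((mem_openSegment_iff_planeDet hyz).1 hty).1
    have h2 : l (f t - z) = l (f t - γ t) := by
      rw [← sub_add_sub_cancel (f t) (γ t) z, map_add, h1, add_zero]
    rw [h2]
    exact (l.le_opNorm _).trans (by gcongr; exact hf.norm_sub_le t htI)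
  have hopen : ∀ s ∈ Icc (t - δ) (t + δ), (f s ∈ openSegment ℝ z y ↔ l (f s - z) = 0) := by
    intro s hs
    rw [mem_openSegment_iff_planeDet hyz, hl0]
    exact ⟨fun h => h.1, fun h => ⟨h, (hρV (hfV s hs)).2⟩⟩
  refine ⟨?_, fun s hs => (hρV (hfV s hs)).1⟩
  have hcont : ContinuousOn (fun s => l (f s - z)) (Icc (t - δ) (t + δ)) :=
    l.continuous.comp_continuousOn
      (((hf.continuousOn h.continuousOn).mono hsub).sub continuousOn_const)
  have hleft := hmono _ hlδ _ htδ htδ.1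
  have hright := hmono _ htδ _ hrδ htδ.2
  rw [abs_le] at hft
  obtain ⟨s, hs, hs0⟩ := intermediate_value_Icc (by linarith : t - δ ≤ t + δ) hcont
    (show (0 : ℝ) ∈ Icc _ _ from ⟨by linarith [hω.2.2, hft.2], by linarith [hω.2.2, hft.1]⟩)
  simp only at hs0
  refine ⟨s, hs, (hopen s hs).2 hs0, fun s' hs' h' => ?_⟩
  have hs0' := (hopen s' hs').1 h'
  rcases le_total s s' with hle | hle
  · have := hmono s hs s' hs' hle
    rw [hs0, hs0'] at this
    nlinarith
  · have := hmono s' hs' s hs hle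
    rw [hs0, hs0'] at this
    nlinarith

/-- The number of crossings of a generic segment with finitely many disjoint arcs does not change
under perturbations of the arcs that are small in the Lipschitz sense. -/
theorem eventually_mem_oddSet_iff {J : Type*} [Finite J] {γ γ' : J → ℝ → Plane} {α β : J → ℝ}
    (h : ∀ j, IsRegularArc (γ j) (γ' j) (α j) (β j))
    (hinj : ∀ j k, ∀ t ∈ Icc (α j) (β j), ∀ s ∈ Icc (α k) (β k), γ j t = γ k s → j = k ∧ t = s)
    {z y : Plane} (hyz : y ≠ z) (hz : ∀ j, ∀ t ∈ Icc (α j) (β j), γ j t ≠ z)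
    (hgen : ∀ j, IsGenericFor z (γ j) (γ' j) (α j) (β j) y) :
    ∀ᶠ ω in 𝓝[>] (0 : ℝ), ∀ f : J → ℝ → Plane,
      (∀ j, IsLipschitzClose (f j) (γ j) (α j) (β j) ω) →
      (y ∈ oddSet (⋃ j, f j '' Icc (α j) (β j)) z ↔
        y ∈ oddSet (⋃ j, γ j '' Icc (α j) (β j)) z) := by
  classical
  set X : Set (J × ℝ) := {x | x.2 ∈ Icc (α x.1) (β x.1) ∧ γ x.1 x.2 ∈ openSegment ℝ z y} with hX
  have hXfin : X.Finite := by
    have : X ⊆ ⋃ j, Prod.mk j '' {t ∈ Icc (α j) (β j) | γ j t ∈ segment ℝ z y} := fun x hx =>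
      mem_iUnion.2 ⟨x.1, x.2, ⟨hx.1, openSegment_subset_segment _ _ _ hx.2⟩, rfl⟩
    exact (finite_iUnion fun j => ((hgen j).finite (h j)).image _).subset this
  have hseg : ∀ j, ∀ t ∈ Icc (α j) (β j), γ j t ∈ segment ℝ z y → (j, t) ∈ X := fun j t ht hty =>
    ⟨ht, mem_openSegment_of_ne_left_right (hz j t ht).symm (hgen j t ht hty).2.2.symm hty⟩
  have hloc : ∀ x ∈ X, x.2 ∈ Ioo (α x.1) (β x.1) ∧ planeDet (y - z) (γ' x.1 x.2) ≠ 0 := by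
    intro x hx
    have := hgen x.1 x.2 hx.1 (openSegment_subset_segment _ _ _ hx.2)
    exact ⟨this.2.1 (hz _ _ hx.1), this.1⟩
  have hpinj : InjOn (fun x : J × ℝ => γ x.1 x.2) X := fun x hx x' hx' hxx =>
    Prod.ext_iff.2 (hinj _ _ _ hx.1 _ hx'.1 hxx)
  -- disjoint neighborhoods of the crossing points
  obtain ⟨V, hV, hVdisj⟩ := (hXfin.image fun x : J × ℝ => γ x.1 x.2).t2_separation
  have hcross : ∀ x ∈ X, ∃ δ > 0, Icc (x.2 - δ) (x.2 + δ) ⊆ Icc (α x.1) (β x.1) ∧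
      ∀ᶠ ω in 𝓝[>] (0 : ℝ), ∀ f : ℝ → Plane, IsLipschitzClose f (γ x.1) (α x.1) (β x.1) ω →
        (∃ s ∈ Icc (x.2 - δ) (x.2 + δ), f s ∈ openSegment ℝ z y ∧
          ∀ s' ∈ Icc (x.2 - δ) (x.2 + δ), f s' ∈ openSegment ℝ z y → s' = s) ∧
        ∀ s ∈ Icc (x.2 - δ) (x.2 + δ), f s ∈ V (γ x.1 x.2) := fun x hx =>
    (h x.1).exists_unique_crossing hyz (hloc x hx).1 hx.2 (hloc x hx).2
      ((hV _).2.mem_nhds (hV _).1)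
  choose! δ hδ hδsub hδev using hcross
  -- away from the crossing parameters the perturbed arcs do not meet the segment
  have hfar : ∀ j, ∀ᶠ ω in 𝓝[>] (0 : ℝ), ∀ f : ℝ → Plane,
      IsLipschitzClose f (γ j) (α j) (β j) ω → ∀ t ∈ Icc (α j) (β j),
        f t ∈ openSegment ℝ z y → ∃ x ∈ X, x.1 = j ∧ t ∈ Icc (x.2 - δ x) (x.2 + δ x) := by
    intro j
    set K := Icc (α j) (β j) \ ⋃ x ∈ {x ∈ X | x.1 = j}, Ioo (x.2 - δ x) (x.2 + δ x)
    have hK : IsCompact (γ j '' K) := by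
      refine (isCompact_Icc.diff (isOpen_biUnion fun x _ => isOpen_Ioo)).image_of_continuousOn
        ((h j).continuousOn.mono sdiff_subset)
    have hdisj : Disjoint (γ j '' K) (segment ℝ z y) := by
      rw [disjoint_left]
      rintro _ ⟨t, ⟨ht, htK⟩, rfl⟩ hty
      have hx := hseg j t ht hty
      exact htK (mem_iUnion₂.2 ⟨(j, t), ⟨hx, rfl⟩, by linarith [hδ _ hx], by linarith [hδ _ hx]⟩)
    obtain ⟨r, hr, hrd⟩ := hdisj.exists_thickenings hK (isClosed_segment z y)
    filter_upwards [Ioo_mem_nhdsGT hr] with ω hω f hf t ht hty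
    by_contra hno
    push Not at hno
    refine disjoint_left.1 hrd (Metric.mem_thickening_iff.2 ⟨γ j t, ⟨t, ⟨ht, fun htU => ?_⟩, rfl⟩,
      ?_⟩) (Metric.self_subset_thickening hr _ (openSegment_subset_segment _ _ _ hty))
    · obtain ⟨x, hx, hxt⟩ := mem_iUnion₂.1 htU
      exact hno x hx.1 hx.2 (Ioo_subset_Icc_self hxt)
    · rw [dist_eq_norm]
      exact (hf.norm_sub_le t ht).trans_lt hω.2
  have hcount : ∀ᶠ ω in 𝓝[>] (0 : ℝ), ∀ f : J → ℝ → Plane,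
      (∀ j, IsLipschitzClose (f j) (γ j) (α j) (β j) ω) →
      ((⋃ j, f j '' Icc (α j) (β j)) ∩ openSegment ℝ z y).Finite ∧
      ((⋃ j, f j '' Icc (α j) (β j)) ∩ openSegment ℝ z y).ncard = X.ncard := by
    filter_upwards [hXfin.eventually_all.2 hδev, eventually_all.2 hfar] with ω h1 h2 f hf
    choose! s hs hsy hsu using fun x hx => (h1 x hx (f x.1) (hf x.1)).1
    have himage : (⋃ j, f j '' Icc (α j) (β j)) ∩ openSegment ℝ z y =
        (fun x : J × ℝ => f x.1 (s x)) '' X := by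
      ext p
      constructor
      · rintro ⟨hp, hpy⟩
        obtain ⟨j, t, ht, rfl⟩ := mem_iUnion.1 hp
        obtain ⟨x, hx, rfl, hxt⟩ := h2 j (f j) (hf j) t ht hpy
        exact ⟨x, hx, congrArg (f x.1) (hsu x hx t hxt hpy).symm⟩
      · rintro ⟨x, hx, rfl⟩
        exact ⟨mem_iUnion.2 ⟨x.1, s x, hδsub x hx (hs x hx), rfl⟩, hsy x hx⟩
    have hinj' : InjOn (fun x : J × ℝ => f x.1 (s x)) X := by
      intro x hx x' hx' hxx
      refine hpinj hx hx' ?_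
      by_contra hne
      refine disjoint_left.1 (hVdisj (mem_image_of_mem _ hx) (mem_image_of_mem _ hx') hne)
        ((h1 x hx (f x.1) (hf x.1)).2 _ (hs x hx)) ?_
      simp only at hxx
      rw [hxx]
      exact (h1 x' hx' (f x'.1) (hf x'.1)).2 _ (hs x' hx')
    rw [himage]
    exact ⟨hXfin.image _, hinj'.ncard_image⟩
  filter_upwards [hcount, self_mem_nhdsWithin] with ω hω hω0 f hf
  have h1 := hω f hf
  have h2 := hω γ fun j => isLipschitzClose_self _ _ _ (le_of_lt hω0)
  simp only [oddSet, mem_ofPred_eq, h1.2, h2.2, h1.1, h2.1, true_and]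

/-! ### Interpolating splines -/

/-- The difference between a chord and its arc is Lipschitz, with the oscillation of the derivative
as a constant. -/
theorem IsRegularArc.chord_lipschitz {γ γ' : ℝ → Plane} {b c : ℝ} (h : IsRegularArc γ γ' b c)
    {ω : ℝ} (hω : ∀ s ∈ Icc b c, ∀ t ∈ Icc b c, ‖γ' s - γ' t‖ ≤ ω) {s t : ℝ} (hs : s ∈ Icc b c)
    (ht : t ∈ Icc b c) :
    ‖(γ b + ((t - b) / (c - b)) • (γ c - γ b) - γ t) -
      (γ b + ((s - b) / (c - b)) • (γ c - γ b) - γ s)‖ ≤ ω * |t - s| := by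
  have hbc : 0 < c - b := sub_pos.2 h.lt
  have hslope : ∀ x ∈ Icc b c, ‖(c - b)⁻¹ • (γ c - γ b) - γ' x‖ ≤ ω := by
    intro x hx
    have hder : ∀ r ∈ Icc b c, HasDerivWithinAt (fun r => γ r - r • γ' x) (γ' r - γ' x)
        (Icc b c) r := fun r hr => by
      have := (h.hasDeriv r hr).sub ((hasDerivWithinAt_id r _).smul_const (γ' x))
      rw [one_smul] at this
      exact this
    have h1 := Convex.norm_image_sub_le_of_norm_hasDerivWithin_le hder
      (fun r hr => hω r hr x hx) (convex_Icc b c) (left_mem_Icc.2 h.lt.le) (right_mem_Icc.2 h.lt.le)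
    rw [Real.norm_eq_abs, abs_of_pos hbc] at h1
    have h2 : (c - b)⁻¹ • (γ c - γ b) - γ' x =
        (c - b)⁻¹ • (γ c - c • γ' x - (γ b - b • γ' x)) := by
      have : γ' x = (c - b)⁻¹ • ((c - b) • γ' x) := by
        rw [smul_smul, inv_mul_cancel₀ hbc.ne', one_smul]
      nth_rewrite 1 [this]
      module
    rw [h2, norm_smul, Real.norm_eq_abs, abs_of_pos (inv_pos.2 hbc), inv_mul_le_iff₀ hbc]
    linarith
  have hder : ∀ x ∈ Icc b c,
      HasDerivWithinAt (fun x => γ b + ((x - b) / (c - b)) • (γ c - γ b) - γ x)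
        ((c - b)⁻¹ • (γ c - γ b) - γ' x) (Icc b c) x := fun x hx => by
    have h1 := ((hasDerivWithinAt_id x (Icc b c)).sub_const b).div_const (c - b)
    have h2 := ((h1.smul_const (γ c - γ b)).const_add (γ b)).sub (h.hasDeriv x hx)
    rw [one_div] at h2
    exact h2
  exact Convex.norm_image_sub_le_of_norm_hasDerivWithin_le hder hslope (convex_Icc b c) hs ht

/-- A linear interpolating spline is parameterized by a map whose difference from the arc is
Lipschitz, with the oscillation of the derivative over one mesh as a constant. -/
theorem IsRegularArc.exists_param_linearSpline {γ γ' : ℝ → Plane} {α β : ℝ}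
    (h : IsRegularArc γ γ' α β) {n : ℕ} (hn : 1 ≤ n) {ω : ℝ}
    (hω : ∀ s ∈ Icc α β, ∀ t ∈ Icc α β, |s - t| ≤ (β - α) / n → ‖γ' s - γ' t‖ ≤ ω) :
    ∃ f : ℝ → Plane, f '' Icc α β = linearSpline γ α β n ∧ f α = γ α ∧
      ∀ s ∈ Icc α β, ∀ t ∈ Icc α β, ‖(f t - γ t) - (f s - γ s)‖ ≤ ω * |t - s| := by
  have hn0 : (0 : ℝ) < n := by exact_mod_cast hn
  set e := (β - α) / n with he
  have he0 : 0 < e := div_pos (sub_pos.2 h.lt) hn0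
  have hω0 : 0 ≤ ω := by
    simpa using hω α (left_mem_Icc.2 h.lt.le) α (left_mem_Icc.2 h.lt.le) (by simpa using he0.le)
  set x : ℕ → ℝ := fun k => α + e * k with hx
  have hxn : x n = β := by simp only [hx, he]; field_simp; ring
  have hx0 : x 0 = α := by simp [hx]
  have hxs : ∀ k, x (k + 1) = x k + e := fun k => by simp only [hx]; push_cast; ring
  have hxα : ∀ k, α ≤ x k := fun k => by
    have : 0 ≤ e * k := by positivity
    simp only [hx]
    linarith
  have hxβ : ∀ k ≤ n, x k ≤ β := fun k hk => by
    rw [← hxn]; simp only [hx]; gcongr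
  -- the point `γ α` is listed separately since there are no edges for `k = 0`
  have main : ∀ k ≤ n, ∃ f : ℝ → Plane,
      f '' Icc α (x k) = {γ α} ∪ ⋃ i ∈ Finset.Icc 1 k,
        segment ℝ (γ (α + e * ((i : ℝ) - 1))) (γ (α + e * (i : ℝ))) ∧
      f α = γ α ∧ f (x k) = γ (x k) ∧
      ∀ s ∈ Icc α (x k), ∀ t ∈ Icc α (x k), s ≤ t →
        ‖(f t - γ t) - (f s - γ s)‖ ≤ ω * (t - s) := by
    intro k
    induction k with
    | zero =>
      intro _
      refine ⟨γ, by simp [hx0], rfl, rfl, fun s _ t _ hst => ?_⟩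
      simpa using mul_nonneg hω0 (sub_nonneg.2 hst)
    | succ k ih =>
      intro hk
      obtain ⟨f, hf1, hf2, hf3, hf4⟩ := ih (by omega)
      have hlt : x k < x (k + 1) := by rw [hxs]; linarith
      have hsub : Icc (x k) (x (k + 1)) ⊆ Icc α β := Icc_subset_Icc (hxα k) (hxβ _ hk)
      set g : ℝ → Plane := fun t =>
        γ (x k) + ((t - x k) / (x (k + 1) - x k)) • (γ (x (k + 1)) - γ (x k)) with hg
      have hgk : g (x k) = γ (x k) := by simp [hg]
      have hgk' : g (x (k + 1)) = γ (x (k + 1)) := by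
        simp only [hg]; rw [div_self (sub_pos.2 hlt).ne', one_smul, add_sub_cancel]
      have hgl : ∀ s ∈ Icc (x k) (x (k + 1)), ∀ t ∈ Icc (x k) (x (k + 1)),
          ‖(g t - γ t) - (g s - γ s)‖ ≤ ω * |t - s| := fun s hs t ht =>
        (h.mono hlt hsub).chord_lipschitz (fun s hs t ht => hω s (hsub hs) t (hsub ht) (by
          rw [hxs] at hs ht
          rw [abs_le]; constructor <;> linarith [hs.1, hs.2, ht.1, ht.2])) hs ht
      have hgim : g '' Icc (x k) (x (k + 1)) = segment ℝ (γ (x k)) (γ (x (k + 1))) := by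
        have hd : 0 < x (k + 1) - x k := sub_pos.2 hlt
        ext p
        rw [mem_segment_iff]
        constructor
        · rintro ⟨t, ht, rfl⟩
          exact ⟨_, ⟨div_nonneg (sub_nonneg.2 ht.1) hd.le,
            (div_le_one hd).2 (by linarith [ht.2])⟩, rfl⟩
        · rintro ⟨s, hs, rfl⟩
          refine ⟨x k + s * (x (k + 1) - x k), ⟨by nlinarith [hs.1], by nlinarith [hs.2]⟩, ?_⟩
          simp only [hg]
          rw [add_sub_cancel_left, mul_div_cancel_right₀ _ hd.ne']
      set F : ℝ → Plane := fun t => if t ≤ x k then f t else g t with hF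
      have hFf : ∀ t, t ≤ x k → F t = f t := fun t ht => if_pos ht
      have hFg : ∀ t, x k ≤ t → F t = g t := fun t ht => by
        rcases ht.eq_or_lt with rfl | ht
        · rw [hFf _ le_rfl, hf3, hgk]
        · exact if_neg ht.not_ge
      refine ⟨F, ?_, by rw [hFf _ (hxα k), hf2], by rw [hFg _ hlt.le, hgk'], ?_⟩
      · rw [← Icc_union_Icc_eq_Icc (hxα k) hlt.le, image_union,
          image_congr (fun t ht => hFf t ht.2), image_congr (fun t ht => hFg t ht.1), hf1, hgim,
          ← Finset.insert_Icc_right_eq_Icc_add_one (by omega : 1 ≤ k + 1),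
          Finset.set_biUnion_insert, union_assoc]
        congr 1
        rw [union_comm]
        congr 3
        simp [hx]
      · intro s hs t ht hst
        by_cases hsk : s ≤ x k
        · by_cases htk : t ≤ x k
          · rw [hFf s hsk, hFf t htk]
            exact hf4 s ⟨hs.1, hsk⟩ t ⟨ht.1, htk⟩ hst
          · have htk' := (not_le.1 htk).le
            rw [hFf s hsk, hFg t htk']
            have h1 := hf4 s ⟨hs.1, hsk⟩ (x k) ⟨hxα k, le_rfl⟩ hsk
            have h2 := hgl (x k) (left_mem_Icc.2 hlt.le) t ⟨htk', ht.2⟩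
            rw [abs_of_nonneg (sub_nonneg.2 htk'), hgk] at h2
            rw [hf3] at h1
            have h3 := norm_sub_le_norm_sub_add_norm_sub (g t - γ t) (γ (x k) - γ (x k)) (f s - γ s)
            linarith
        · have hsk' := (not_le.1 hsk).le
          rw [hFg s hsk', hFg t (hsk'.trans hst)]
          have := hgl s ⟨hsk', hs.2⟩ t ⟨hsk'.trans hst, ht.2⟩
          rwa [abs_of_nonneg (sub_nonneg.2 hst)] at this
  obtain ⟨f, hf1, hf2, -, hf4⟩ := main n le_rfl
  rw [hxn] at hf1 hf4
  refine ⟨f, ?_, hf2, fun s hs t ht => ?_⟩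
  · rw [hf1, linearSpline, union_eq_right, singleton_subset_iff]
    refine mem_iUnion₂.2 ⟨1, by simpa using hn, ?_⟩
    convert left_mem_segment ℝ _ _ using 2
    simp
  · rcases le_total s t with hst | hst
    · rw [abs_of_nonneg (sub_nonneg.2 hst)]
      exact hf4 s hs t ht hst
    · rw [norm_sub_rev, abs_sub_comm, abs_of_nonneg (sub_nonneg.2 hst)]
      exact hf4 t ht s hs hst

theorem IsRegularArc.eventually_exists_param_linearSpline {γ γ' : ℝ → Plane} {α β : ℝ}
    (h : IsRegularArc γ γ' α β) {ω : ℝ} (hω : 0 < ω) :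
    ∀ᶠ n : ℕ in atTop, ∃ f : ℝ → Plane, f '' Icc α β = linearSpline γ α β n ∧
      IsLipschitzClose f γ α β ω := by
  have hd : 0 < β - α := sub_pos.2 h.lt
  set ω' := ω / (1 + (β - α)) with hω'
  have hω'0 : 0 < ω' := by positivity
  have h1 : ω' * (1 + (β - α)) = ω := by rw [hω']; field_simp
  have huc := isCompact_Icc.uniformContinuousOn_of_continuous h.continuousOn_deriv
  obtain ⟨δ, hδ, hu⟩ := Metric.uniformContinuousOn_iff.1 huc ω' hω'0
  have hlim : ∀ᶠ n : ℕ in atTop, (β - α) / n < δ :=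
    (tendsto_const_div_atTop_nhds_zero_nat (β - α)).eventually_lt_const hδ
  filter_upwards [hlim, eventually_ge_atTop 1] with n hn hn1
  obtain ⟨f, hf1, hf2, hf3⟩ := h.exists_param_linearSpline hn1 (ω := ω') (fun s hs t ht hst => by
    rw [← dist_eq_norm]
    exact (hu s hs t ht (by rw [Real.dist_eq]; linarith)).le)
  refine ⟨f, hf1, fun t ht => ?_, fun s hs t ht => (hf3 s hs t ht).trans ?_⟩
  · have h2 := hf3 α (left_mem_Icc.2 h.lt.le) t ht
    rw [hf2, sub_self, sub_zero, abs_of_nonneg (sub_nonneg.2 ht.1)] at h2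
    nlinarith [ht.2]
  · gcongr
    nlinarith

theorem isClosed_linearSpline (γ : ℝ → Plane) (α β : ℝ) (n : ℕ) :
    IsClosed (linearSpline γ α β n) :=
  isClosed_biUnion_finset fun _ _ => isClosed_segment _ _

/-- Almost every segment from `z` is parallel to none of the edges of finitely many splines. -/
theorem ae_isTransversal_iUnion_linearSpline {J : Type*} [Finite J] {γ : J → ℝ → Plane}
    {α β : J → ℝ} (hlt : ∀ j, α j < β j) (hinj : ∀ j, InjOn (γ j) (Icc (α j) (β j)))
    (z : Plane) {n : ℕ} (hn : 1 ≤ n) :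
    ∀ᵐ y, IsTransversal (⋃ j, linearSpline (γ j) (α j) (β j) n) z y := by
  classical
  have := Fintype.ofFinite J
  have hn0 : (0 : ℝ) < n := by exact_mod_cast hn
  set b : J → ℕ → Plane := fun j k => γ j (α j + (β j - α j) / n * ((k : ℝ) - 1))
  set c : J → ℕ → Plane := fun j k => γ j (α j + (β j - α j) / n * (k : ℝ))
  have hbc : ∀ j, ∀ k ∈ Finset.Icc 1 n, c j k - b j k ≠ 0 := by
    intro j k hk h0
    rw [Finset.mem_Icc] at hk
    have h1 : (1 : ℝ) ≤ k := by exact_mod_cast hk.1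
    have h2 : (k : ℝ) ≤ n := by exact_mod_cast hk.2
    have hd := sub_pos.2 (hlt j)
    have he : 0 < (β j - α j) / n := div_pos hd hn0
    have hen : (β j - α j) / n * n = β j - α j := by field_simp
    have h3 := hinj j ⟨by nlinarith, by nlinarith⟩ ⟨by nlinarith, by nlinarith⟩ (sub_eq_zero.1 h0)
    nlinarith
  have hae : ∀ᵐ y : Plane, ∀ j, ∀ k ∈ Finset.Icc 1 n, planeDet (c j k - b j k) (y - z) ≠ 0 :=
    ae_all_iff.2 fun j => (Finset.eventually_all _).2 fun k hk =>
      ae_planeDet_sub_ne_zero z (hbc j k hk)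
  filter_upwards [hae] with y hy p hp
  have h1 : (⋃ j, linearSpline (γ j) (α j) (β j) n) =
      ⋃ j ∈ (Finset.univ : Finset J), linearSpline (γ j) (α j) (β j) n := by simp
  rw [h1]
  refine notMem_tangentConeAt_biUnion _ fun j _ => notMem_tangentConeAt_biUnion _ fun k hk hv => ?_
  exact hy j k hk (planeDet_eq_zero_of_mem_tangentConeAt_segment hv)

/-! ### Decomposition of a curve into arcs that avoid the center -/

theorem IsRegularC1Holder.mono {a : ℝ} {γ : ℝ → Plane} {α β c d : ℝ}
    (h : IsRegularC1Holder a γ α β) (hcd : c < d) (hsub : Icc c d ⊆ Icc α β) :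
    IsRegularC1Holder a γ c d := by
  obtain ⟨h1, h2, K, hK⟩ := h
  have hder : ∀ t ∈ Icc c d, derivWithin γ (Icc c d) t = derivWithin γ (Icc α β) t := fun t ht =>
    (((h1.differentiableOn one_ne_zero) t (hsub ht)).hasDerivWithinAt.mono hsub).derivWithin
      (uniqueDiffOn_Icc hcd t ht)
  refine ⟨h1.mono hsub, fun t ht => ?_, K, fun s hs t ht => ?_⟩
  · rw [hder t ht]; exact h2 t (hsub ht)
  · rw [hder s hs, hder t ht]; exact hK s (hsub hs) t (hsub ht)

theorem IsRegularC1Holder.isRegularArc {a : ℝ} {γ : ℝ → Plane} {α β : ℝ}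
    (h : IsRegularC1Holder a γ α β) (hlt : α < β) :
    IsRegularArc γ (derivWithin γ (Icc α β)) α β :=
  ⟨hlt, fun t ht => ((h.1.differentiableOn one_ne_zero) t ht).hasDerivWithinAt,
    h.1.continuousOn_derivWithin (uniqueDiffOn_Icc hlt) le_rfl, h.2.1⟩

/-- A decomposition of the curve `C`, up to endpoints, into open arcs that do not pass through `z`.
The endpoints of the arcs may or may not belong to `C`, and arcs may have them in common. The
condition `simple` says that an interior point of an arc is passed only once by the closed arcs. -/
structure ArcSystem (a : ℝ) (z : Plane) (C : Set Plane) where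
  /-- The index set of the arcs. -/
  J : Type
  /-- The parameterizations of the arcs. -/
  γ : J → ℝ → Plane
  /-- The derivatives of the parameterizations. -/
  γ' : J → ℝ → Plane
  /-- The initial parameters. -/
  α : J → ℝ
  /-- The final parameters. -/
  β : J → ℝ
  regular : ∀ j, IsRegularArc (γ j) (γ' j) (α j) (β j)
  holder : ∀ j, ∃ K, ∀ s ∈ Icc (α j) (β j), ∀ t ∈ Icc (α j) (β j),
    ‖γ' j s - γ' j t‖ ≤ K * |s - t| ^ a
  isRegularC1Holder : ∀ j c d, c < d → Icc c d ⊆ Icc (α j) (β j) → IsRegularC1Holder a (γ j) c d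
  ne_center : ∀ j, ∀ t ∈ Ioo (α j) (β j), γ j t ≠ z
  simple : ∀ j k, ∀ t ∈ Ioo (α j) (β j), ∀ s ∈ Icc (α k) (β k), γ j t = γ k s → j = k ∧ t = s
  locallyFinite : LocallyFinite fun j => γ j '' Icc (α j) (β j)
  image_subset : ∀ j, γ j '' Ioo (α j) (β j) ⊆ C
  subset_iUnion : C ⊆ ⋃ j, γ j '' Icc (α j) (β j)

/-- Each component is cut at the parameter of `z`, if `z` is an interior point of it, or else at an
arbitrary parameter. -/
theorem IsC1HolderCurve.nonempty_arcSystem {a : ℝ} {C : Set Plane} (hC : IsC1HolderCurve a C)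
    (z : Plane) : Nonempty (ArcSystem a z C) := by
  obtain ⟨ι, γ, I, hγ, hdisj, hlf, -, rfl⟩ := hC
  have hreg : ∀ i, IsRegularC1Holder a (γ i) 0 1 := fun i => by
    rcases hγ i with h | h
    · exact h.1.2.1
    · exact h.1.2.1
  have hI : ∀ i, Ioo 0 1 ⊆ I i ∧ I i ⊆ Icc 0 1 := fun i => by
    rcases hγ i with h | h
    · exact h.2
    · rw [h.2]; exact ⟨Ioo_subset_Icc_self, subset_rfl⟩
  have hinj : ∀ i, ∀ t ∈ Ioo (0 : ℝ) 1, ∀ s ∈ Icc (0 : ℝ) 1, γ i t = γ i s → t = s := by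
    intro i t ht s hs hts
    rcases hγ i with h | h
    · exact h.1.2.2 (Ioo_subset_Icc_self ht) hs hts
    · rcases hs.2.eq_or_lt with rfl | hs1
      · rw [← h.1.2.2.2.1] at hts
        have := h.1.2.2.1 (Ioo_subset_Ico_self ht) ⟨le_rfl, zero_lt_one⟩ hts
        exact absurd this ht.1.ne'
      · exact h.1.2.2.1 (Ioo_subset_Ico_self ht) ⟨hs.1, hs1⟩ hts
  have hcut : ∀ i, ∃ τ ∈ Ioo (0 : ℝ) 1, ∀ t ∈ Ioo (0 : ℝ) 1, γ i t = z → t = τ := by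
    intro i
    by_cases h : ∃ t ∈ Ioo (0 : ℝ) 1, γ i t = z
    · obtain ⟨τ, hτ, hz⟩ := h
      exact ⟨τ, hτ, fun t ht htz => hinj i t ht τ (Ioo_subset_Icc_self hτ) (htz.trans hz.symm)⟩
    · push Not at h
      exact ⟨1 / 2, by norm_num, fun t ht htz => absurd htz (h t ht)⟩
  choose τ hτ hτz using hcut
  let α : ι × Bool → ℝ := fun j => if j.2 then τ j.1 else 0
  let β : ι × Bool → ℝ := fun j => if j.2 then 1 else τ j.1
  have hlt : ∀ j, α j < β j := by
    rintro ⟨i, b⟩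
    cases b <;> simp [α, β, (hτ i).1, (hτ i).2]
  have hsub : ∀ j, Icc (α j) (β j) ⊆ Icc 0 1 := by
    rintro ⟨i, b⟩
    cases b
    · exact Icc_subset_Icc le_rfl (hτ i).2.le
    · exact Icc_subset_Icc (hτ i).1.le le_rfl
  have hsub' : ∀ j, Ioo (α j) (β j) ⊆ Ioo 0 1 := by
    rintro ⟨i, b⟩
    cases b
    · exact Ioo_subset_Ioo le_rfl (hτ i).2.le
    · exact Ioo_subset_Ioo (hτ i).1.le le_rfl
  refine ⟨⟨ι × Bool, fun j => γ j.1, fun j => derivWithin (γ j.1) (Icc 0 1), α, β,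
    fun j => ((hreg j.1).isRegularArc zero_lt_one).mono (hlt j) (hsub j), fun j => ?_,
    fun j c d hcd hs => (hreg j.1).mono hcd (hs.trans (hsub j)), ?_, ?_, ?_, ?_, ?_⟩⟩
  · obtain ⟨K, hK⟩ := (hreg j.1).2.2
    exact ⟨K, fun s hs t ht => hK s (hsub j hs) t (hsub j ht)⟩
  · rintro ⟨i, b⟩ t ht htz
    have := hτz i t (hsub' (i, b) ht) htz
    cases b
    · exact absurd this ht.2.ne
    · exact absurd this ht.1.ne'
  · rintro ⟨i, b⟩ ⟨k, b'⟩ t ht s hs hts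
    by_cases hik : i = k
    · subst hik
      have h1 := hinj i t (hsub' (i, b) ht) s (hsub (i, b') hs) hts
      subst h1
      refine ⟨?_, rfl⟩
      cases b <;> cases b'
      · rfl
      · exact absurd hs.1 ht.2.not_ge
      · exact absurd hs.2 ht.1.not_ge
      · rfl
    · exact absurd hts (fun h => disjoint_left.1 (hdisj hik)
        ⟨t, Ioo_subset_Icc_self (hsub' (i, b) ht), h⟩ ⟨s, hsub (k, b') hs, rfl⟩)
  · intro x
    obtain ⟨U, hU, hfin⟩ := hlf x
    refine ⟨U, hU, (hfin.prod (finite_univ : (univ : Set Bool).Finite)).subset ?_⟩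
    rintro ⟨i, b⟩ hj
    exact ⟨hj.mono (inter_subset_inter_left _ (image_mono (hsub (i, b)))), mem_univ _⟩
  · intro j
    exact (image_mono ((hsub' j).trans (hI j.1).1)).trans
      (subset_iUnion (fun i => γ i '' I i) j.1)
  · refine iUnion_subset fun i => ?_
    rintro _ ⟨t, ht, rfl⟩
    have ht' := (hI i).2 ht
    rcases le_total t (τ i) with h | h
    · exact mem_iUnion.2 ⟨(i, false), t, ⟨ht'.1, h⟩, rfl⟩
    · exact mem_iUnion.2 ⟨(i, true), t, ⟨h, ht'.2⟩, rfl⟩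

namespace ArcSystem

variable {a : ℝ} {z : Plane} {C : Set Plane} (A : ArcSystem a z C)

theorem countable : Countable A.J := by
  have := A.locallyFinite.countable_univ fun j => (nonempty_Icc.2 (A.regular j).lt.le).image _
  exact countable_univ_iff.1 this

theorem ae_isGenericFor :
    ∀ᵐ y, ∀ j, IsGenericFor z (A.γ j) (A.γ' j) (A.α j) (A.β j) y := by
  have := A.countable
  exact ae_all_iff.2 fun j => (A.regular j).ae_isGenericFor z (A.ne_center j)

theorem exists_of_mem {y p : Plane} (hyz : y ≠ z)
    (hy : ∀ j, IsGenericFor z (A.γ j) (A.γ' j) (A.α j) (A.β j) y) (hp : p ∈ C)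
    (hpy : p ∈ openSegment ℝ z y) : ∃ j, ∃ t ∈ Ioo (A.α j) (A.β j), A.γ j t = p := by
  obtain ⟨j, t, ht, rfl⟩ := mem_iUnion.1 (A.subset_iUnion hp)
  exact ⟨j, t, (hy j t ht (openSegment_subset_segment _ _ _ hpy)).2.1
    (ne_left_of_mem_openSegment hyz hpy), rfl⟩

theorem finite_inter {y : Plane} (hy : ∀ j, IsGenericFor z (A.γ j) (A.γ' j) (A.α j) (A.β j) y) :
    (C ∩ openSegment ℝ z y).Finite := by
  have hcpt : IsCompact (segment ℝ z y) := by
    rw [segment_eq_image']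
    exact isCompact_Icc.image (by fun_prop)
  refine ((A.locallyFinite.finite_nonempty_inter_compact hcpt).biUnion fun j _ =>
    ((hy j).finite (A.regular j)).image (A.γ j)).subset ?_
  rintro p ⟨hp, hpy⟩
  obtain ⟨j, t, ht, rfl⟩ := mem_iUnion.1 (A.subset_iUnion hp)
  have hpy' := openSegment_subset_segment _ _ _ hpy
  exact mem_iUnion₂.2 ⟨j, ⟨A.γ j t, ⟨t, ht, rfl⟩, hpy'⟩, t, ⟨ht, hpy'⟩, rfl⟩

theorem nhdsWithin_le_map {j : A.J} {t : ℝ} (ht : t ∈ Ioo (A.α j) (A.β j)) :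
    𝓝[C] (A.γ j t) ≤ map (A.γ j) (𝓝[Icc (A.α j) (A.β j)] t) := by
  set B : Set Plane := ⋃ k : {k // k ≠ j}, A.γ k '' Icc (A.α k) (A.β k) with hB
  have hBc : IsClosed B := (A.locallyFinite.comp_injective
    (Subtype.val_injective (p := fun k => k ≠ j))).isClosed_iUnion fun k =>
      (A.regular k).isCompact_image.isClosed
  have hB' : A.γ j t ∉ B := by
    intro h
    obtain ⟨k, s, hs, hst⟩ := mem_iUnion.1 h
    exact k.2 (A.simple j k t ht s hs hst.symm).1.symm
  have hsub : C ⊆ A.γ j '' Icc (A.α j) (A.β j) ∪ B := by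
    intro p hp
    obtain ⟨k, hk⟩ := mem_iUnion.1 (A.subset_iUnion hp)
    by_cases hkj : k = j
    · subst hkj; exact Or.inl hk
    · exact Or.inr (mem_iUnion.2 ⟨⟨k, hkj⟩, hk⟩)
  calc 𝓝[C] (A.γ j t) ≤ 𝓝[A.γ j '' Icc (A.α j) (A.β j) ∪ B] (A.γ j t) := nhdsWithin_mono _ hsub
    _ = 𝓝[A.γ j '' Icc (A.α j) (A.β j)] (A.γ j t) := by
      have hbot : 𝓝[B] (A.γ j t) = ⊥ := by
        rwa [← notMem_closure_iff_nhdsWithin_eq_bot, hBc.closure_eq]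
      rw [nhdsWithin_union, hbot, sup_bot_eq]
    _ ≤ _ := nhdsWithin_image_le_map (A.regular j).continuousOn fun s hs hst =>
      (A.simple j j t ht s hs hst.symm).2.symm

theorem isTransversal {y : Plane} (hyz : y ≠ z)
    (hy : ∀ j, IsGenericFor z (A.γ j) (A.γ' j) (A.α j) (A.β j) y) : IsTransversal C z y := by
  rintro p ⟨hp, hpy⟩ hv
  obtain ⟨j, t, ht, rfl⟩ := A.exists_of_mem hyz hy hp hpy
  have htI := Ioo_subset_Icc_self ht
  have h0 := (A.regular j).planeDet_eq_zero_of_mem_tangentConeAt htI (A.nhdsWithin_le_map ht) hv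
  rw [planeDet_swap, neg_eq_zero] at h0
  exact (hy j t htI (openSegment_subset_segment _ _ _ hpy)).1 h0

theorem hasIntegrableShadow (A : ArcSystem a z C) {σ : ℝ} (hσ : 0 < σ) (ha : σ < a) :
    HasIntegrableShadow σ z C :=
  (HasIntegrableShadow.iUnion_of_locallyFinite hσ A.locallyFinite fun j =>
    (A.holder j).elim fun _ hK => .of_isRegularArc hσ ha (A.regular j) hK).mono A.subset_iUnion

/-! ### Exhaustion by finitely many closed arcs -/

/-- The amount by which the `j`-th arc is shortened at both ends in the `m`-th step. -/
noncomputable def gap (m : ℕ) (j : A.J) : ℝ := (A.β j - A.α j) / ((m : ℝ) + 3)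

theorem gap_pos (m : ℕ) (j : A.J) : 0 < A.gap m j :=
  div_pos (sub_pos.2 (A.regular j).lt) (by positivity)

theorem add_gap_lt (m : ℕ) (j : A.J) : A.α j + A.gap m j < A.β j - A.gap m j := by
  have h1 := A.gap_pos m j
  have h2 : A.gap m j * ((m : ℝ) + 3) = A.β j - A.α j := by unfold gap; field_simp
  have h3 : (0 : ℝ) ≤ m := by positivity
  nlinarith

theorem tendsto_gap (j : A.J) : Tendsto (fun m => A.gap m j) atTop (𝓝 0) :=
  tendsto_const_nhds.div_atTop (tendsto_atTop_add_const_right _ _ tendsto_natCast_atTop_atTop)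

theorem Icc_gap_subset (m : ℕ) (j : A.J) :
    Icc (A.α j + A.gap m j) (A.β j - A.gap m j) ⊆ Ioo (A.α j) (A.β j) := fun t ht => by
  have := A.gap_pos m j
  exact ⟨by linarith [ht.1], by linarith [ht.2]⟩

theorem regular_gap (m : ℕ) (j : A.J) :
    IsRegularArc (A.γ j) (A.γ' j) (A.α j + A.gap m j) (A.β j - A.gap m j) :=
  (A.regular j).mono (A.add_gap_lt m j) ((A.Icc_gap_subset m j).trans Ioo_subset_Icc_self)

theorem isArcParam_gap (m : ℕ) (j : A.J) :
    IsArcParam a (A.γ j) (A.α j + A.gap m j) (A.β j - A.gap m j) :=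
  ⟨A.add_gap_lt m j, A.isRegularC1Holder j _ _ (A.add_gap_lt m j)
    ((A.Icc_gap_subset m j).trans Ioo_subset_Icc_self), fun t ht s hs hts =>
      (A.simple j j t (A.Icc_gap_subset m j ht) s
        (Ioo_subset_Icc_self (A.Icc_gap_subset m j hs)) hts).2⟩

/-- A finite union of closed arcs in the curve. -/
def exhaustion (e : A.J → ℕ) (m : ℕ) : Set Plane :=
  ⋃ j : {j // e j ≤ m}, A.γ j '' Icc (A.α j + A.gap m j) (A.β j - A.gap m j)

variable {e : A.J → ℕ}

theorem finite_index (he : Function.Injective e) (m : ℕ) : Finite {j // e j ≤ m} :=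
  Set.finite_coe_iff.2 ((finite_Iic m).preimage he.injOn)

theorem isClosed_exhaustion (he : Function.Injective e) (m : ℕ) : IsClosed (A.exhaustion e m) :=
  have := A.finite_index he m
  isClosed_iUnion_of_finite fun j => (A.regular_gap m j).isCompact_image.isClosed

theorem exhaustion_subset (m : ℕ) : A.exhaustion e m ⊆ C :=
  iUnion_subset fun j => (image_mono (A.Icc_gap_subset m j)).trans (A.image_subset j)

theorem center_notMem_exhaustion (m : ℕ) : z ∉ A.exhaustion e m := by
  intro h
  obtain ⟨j, t, ht, htz⟩ := mem_iUnion.1 h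
  exact A.ne_center j t (A.Icc_gap_subset m j ht) htz

/-- For a generic segment, all crossing points are eventually in the exhausting sets. -/
theorem eventually_mem_oddSet_iff {y : Plane} (hyz : y ≠ z)
    (hy : ∀ j, IsGenericFor z (A.γ j) (A.γ' j) (A.α j) (A.β j) y) :
    ∀ᶠ m in atTop, y ∈ oddSet (A.exhaustion e m) z ↔ y ∈ oddSet C z := by
  have hev : ∀ p ∈ C ∩ openSegment ℝ z y, ∀ᶠ m in atTop, p ∈ A.exhaustion e m := by
    rintro p ⟨hp, hpy⟩
    obtain ⟨j, t, ht, rfl⟩ := A.exists_of_mem hyz hy hp hpy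
    filter_upwards [eventually_ge_atTop (e j),
      (A.tendsto_gap j).eventually_lt_const (sub_pos.2 ht.1),
      (A.tendsto_gap j).eventually_lt_const (sub_pos.2 ht.2)] with m hm h1 h2
    exact mem_iUnion.2 ⟨⟨j, hm⟩, t, ⟨by linarith, by linarith⟩, rfl⟩
  filter_upwards [(A.finite_inter hy).eventually_all.2 hev] with m hm
  have : A.exhaustion e m ∩ openSegment ℝ z y = C ∩ openSegment ℝ z y :=
    Subset.antisymm (inter_subset_inter_left _ (A.exhaustion_subset m))
      fun p hp => ⟨hm p hp, hp.2⟩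
  simp only [oddSet, mem_ofPred_eq, this]

end ArcSystem

theorem nonempty_inter_of_mem_oddSet {A : Set Plane} {z y : Plane} (h : y ∈ oddSet A z) :
    (A ∩ openSegment ℝ z y).Nonempty :=
  nonempty_of_ncard_ne_zero h.2.pos.ne'

namespace ArcSystem

variable {a : ℝ} {z : Plane} {C : Set Plane} (A : ArcSystem a z C) {e : A.J → ℕ}

theorem tendsto_exhaustion {σ : ℝ} (hσ : 0 < σ) (ha : σ < a) (he : Function.Injective e)
    (u : Plane) :
    NullMeasurableSet (oddSet C z) ∧ IntegrableOn (kernelAt σ z) (oddSet C z) ∧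
      Tendsto (fun m => curvatureIntegral σ z u (oddSet (A.exhaustion e m) z)) atTop
        (𝓝 (curvatureIntegral σ z u (oddSet C z))) := by
  obtain ⟨H, hH, hint, hsub⟩ := A.hasIntegrableShadow hσ ha
  refine tendsto_curvatureIntegral u
    (fun m => nullMeasurableSet_oddSet (A.isClosed_exhaustion he m) z) hH hint
    (Eventually.of_forall fun m => ?_) ?_
  · filter_upwards [Measure.ae_ne volume z] with y hy hyo
    exact hsub y hy ((nonempty_inter_of_mem_oddSet hyo).mono
      (inter_subset_inter_left _ (A.exhaustion_subset m)))
  · filter_upwards [Measure.ae_ne volume z, A.ae_isGenericFor] with y hy hgen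
    exact A.eventually_mem_oddSet_iff hy hgen

/-- The union of the splines with `n` edges that interpolate the arcs of an exhausting set. -/
def splines (e : A.J → ℕ) (m n : ℕ) : Set Plane :=
  ⋃ j : {j // e j ≤ m}, linearSpline (A.γ j) (A.α j + A.gap m j) (A.β j - A.gap m j) n

theorem isClosed_splines (he : Function.Injective e) (m n : ℕ) : IsClosed (A.splines e m n) :=
  have := A.finite_index he m
  isClosed_iUnion_of_finite fun _ => isClosed_linearSpline _ _ _ _

theorem eventually_exists_param_splines (he : Function.Injective e) (m : ℕ) {ω : ℝ} (hω : 0 < ω) :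
    ∀ᶠ n in atTop, ∃ f : {j // e j ≤ m} → ℝ → Plane,
      A.splines e m n = ⋃ j, f j '' Icc (A.α j + A.gap m j) (A.β j - A.gap m j) ∧
      ∀ j, IsLipschitzClose (f j) (A.γ j) (A.α j + A.gap m j) (A.β j - A.gap m j) ω := by
  have := A.finite_index he m
  filter_upwards [eventually_all.2 fun j : {j // e j ≤ m} =>
    (A.regular_gap m j).eventually_exists_param_linearSpline hω] with n hn
  choose f hf1 hf2 using hn
  exact ⟨f, iUnion_congr fun j => (hf1 j).symm, hf2⟩

/-- The splines stay away from `z`, since the exhausting set does. -/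
theorem exists_ball_disjoint_splines (he : Function.Injective e) (m : ℕ) :
    ∃ r > 0, ∀ᶠ n in atTop, Disjoint (A.splines e m n) (Metric.ball z r) := by
  obtain ⟨r, hr, hball⟩ := Metric.isOpen_iff.1 (A.isClosed_exhaustion he m).isOpen_compl z
    (A.center_notMem_exhaustion m)
  refine ⟨r / 2, half_pos hr, ?_⟩
  filter_upwards [A.eventually_exists_param_splines he m (half_pos hr)] with n hn
  obtain ⟨f, hf, hclose⟩ := hn
  rw [hf, disjoint_left]
  intro p hp hpb
  obtain ⟨j, t, ht, rfl⟩ := mem_iUnion.1 hp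
  have h1 := (hclose j).norm_sub_le t ht
  rw [← dist_eq_norm] at h1
  refine hball (?_ : A.γ j t ∈ Metric.ball z r) (mem_iUnion.2 ⟨j, t, ht, rfl⟩)
  rw [Metric.mem_ball] at hpb ⊢
  linarith [dist_triangle_left (A.γ j t) z (f j t)]

theorem tendsto_splines {σ : ℝ} (hσ : 0 < σ) (he : Function.Injective e) (m : ℕ) (u : Plane) :
    (∀ᶠ n in atTop, z ∉ A.splines e m n ∧
      IntegrableOn (kernelAt σ z) (oddSet (A.splines e m n) z)) ∧
      Tendsto (fun n => curvatureIntegral σ z u (oddSet (A.splines e m n) z)) atTop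
        (𝓝 (curvatureIntegral σ z u (oddSet (A.exhaustion e m) z))) := by
  have hfin := A.finite_index he m
  obtain ⟨r, hr, hdisj⟩ := A.exists_ball_disjoint_splines he m
  have hint := integrableOn_kernelAt_compl_ball hσ z hr
  have hsub : ∀ᶠ n in atTop, ∀ᵐ y, y ∈ oddSet (A.splines e m n) z → y ∈ (Metric.ball z r)ᶜ := by
    filter_upwards [hdisj] with n hn
    filter_upwards [Measure.ae_ne volume z] with y hyz hy hyb
    obtain ⟨p, hp, hpy⟩ := nonempty_inter_of_mem_oddSet hy
    refine disjoint_left.1 hn hp ?_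
    rw [Metric.mem_ball, dist_eq_norm] at hyb ⊢
    exact (norm_sub_lt_of_mem_openSegment hyz hpy).trans hyb
  refine ⟨?_, (tendsto_curvatureIntegral u
    (fun n => nullMeasurableSet_oddSet (A.isClosed_splines he m n) z)
    Metric.isOpen_ball.measurableSet.compl hint hsub ?_).2.2⟩
  · filter_upwards [hdisj, hsub] with n h1 h2
    exact ⟨fun hz => disjoint_left.1 h1 hz (Metric.mem_ball_self hr), hint.mono_set_ae h2⟩
  · have hgen : ∀ᵐ y, ∀ j : {j // e j ≤ m}, IsGenericFor z (A.γ j) (A.γ' j)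
        (A.α j + A.gap m j) (A.β j - A.gap m j) y :=
      ae_all_iff.2 fun j => (A.regular_gap m j).ae_isGenericFor z fun t ht =>
        A.ne_center j t (A.Icc_gap_subset m j (Ioo_subset_Icc_self ht))
    filter_upwards [Measure.ae_ne volume z, hgen] with y hyz hy
    have hev := _root_.eventually_mem_oddSet_iff (fun j : {j // e j ≤ m} => A.regular_gap m j)
      (fun j k t ht s hs hts => ?_) hyz
      (fun j t ht => A.ne_center j t (A.Icc_gap_subset m j ht)) hy
    · obtain ⟨ω, hω, hω0⟩ := (hev.and self_mem_nhdsWithin).exists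
      filter_upwards [A.eventually_exists_param_splines he m hω0] with n hn
      obtain ⟨f, hf, hclose⟩ := hn
      rw [hf]
      exact hω f hclose
    · have := A.simple j k t (A.Icc_gap_subset m j ht) s
        (Ioo_subset_Icc_self (A.Icc_gap_subset m k hs)) hts
      exact ⟨Subtype.ext this.1, this.2⟩

end ArcSystem

theorem theorem1 (σ a : ℝ) (hσ0 : 0 < σ) (hσ1 : σ < 1) (ha : σ < a)
    (C : Set Plane) (hC : IsC1HolderCurve a C)
    (z u : Plane) (hu : ‖u‖ = 1) (hzu : z ∈ C → IsNormalAt C z u)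
    (ε : ℝ) (hε : 0 < ε) :
    ∃ κC : ℝ, HasNonlocalCurvature σ C z u κC ∧
      ∃ (ι : Type) (_ : Countable ι) (D S : ι → Set Plane),
        (∀ i, D i ⊆ C) ∧
        Pairwise (fun i j => Disjoint (D i) (D j)) ∧
        (∀ i, IsLinearSplineOf a (D i) (S i)) ∧
        ∃ κS : ℝ, HasNonlocalCurvature σ (⋃ i, S i) z u κS ∧ |κC - κS| < ε := by
  obtain ⟨A⟩ := hC.nonempty_arcSystem z
  have := A.countable
  obtain ⟨e, he⟩ := exists_injective_nat A.J
  obtain ⟨hmeas, hint, hlim⟩ := A.tendsto_exhaustion hσ0 ha he u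
  refine ⟨curvatureIntegral σ z u (oddSet C z),
    hasNonlocalCurvature_curvatureIntegral hσ0 hu hmeas hint ?_ hzu, ?_⟩
  · filter_upwards [Measure.ae_ne volume z, A.ae_isGenericFor] with y hy hgen
    exact A.isTransversal hy hgen
  obtain ⟨m, hm⟩ := (hlim.eventually_mem (Metric.ball_mem_nhds _ (half_pos hε))).exists
  obtain ⟨hgood, hlim'⟩ := A.tendsto_splines hσ0 he m u
  obtain ⟨n, hn, ⟨hz, hint'⟩, hn1⟩ := ((hlim'.eventually_mem
    (Metric.ball_mem_nhds _ (half_pos hε))).and (hgood.and (eventually_ge_atTop 1))).exists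
  have hfin := A.finite_index he m
  refine ⟨{j // e j ≤ m}, inferInstance,
    fun j => A.γ j '' Icc (A.α j + A.gap m j) (A.β j - A.gap m j),
    fun j => linearSpline (A.γ j) (A.α j + A.gap m j) (A.β j - A.gap m j) n,
    fun j => (image_mono (A.Icc_gap_subset m j)).trans (A.image_subset j), fun j k hjk => ?_,
    fun j => ⟨A.γ j, _, _, n, hn1, Or.inl (A.isArcParam_gap m j), rfl, rfl⟩,
    curvatureIntegral σ z u (oddSet (A.splines e m n) z), ?_, ?_⟩
  · refine disjoint_left.2 ?_
    rintro _ ⟨t, ht, rfl⟩ ⟨s, hs, hst⟩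
    exact hjk (Subtype.ext (A.simple j k t (A.Icc_gap_subset m j ht) s
      (Ioo_subset_Icc_self (A.Icc_gap_subset m k hs)) hst.symm).1)
  · exact hasNonlocalCurvature_curvatureIntegral hσ0 hu
      (nullMeasurableSet_oddSet (A.isClosed_splines he m n) z) hint'
      (ae_isTransversal_iUnion_linearSpline (fun j : {j // e j ≤ m} => A.add_gap_lt m j)
        (fun j => (A.isArcParam_gap m j).2.2) z hn1) fun h => absurd h hz
  · rw [Metric.mem_ball, Real.dist_eq] at hm hn
    rw [abs_sub_comm] at hm hn
    calc |curvatureIntegral σ z u (oddSet C z) -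
          curvatureIntegral σ z u (oddSet (A.splines e m n) z)|
        ≤ _ := abs_sub_le _ (curvatureIntegral σ z u (oddSet (A.exhaustion e m) z)) _
      _ < ε := by linarith
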